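/- Let $n\ge 2$, let $A$ be a commutative associative unital $\mathbb C$-algebra, and let $e_{i,j}$ be the matrix units. Put $h_i=e_{i,i}-e_{i+1,i+1}$ and $x_{-i}=e_{i+1,i}$ for $1\le i\le n-1$, $\mathfrak h=\operatorname{span}\{h_i\}$, $\mathfrak n^+=\operatorname{span}\{e_{i,j}\mid i<j\}\subset\mathfrak{sl}_n$, and let $\omega_i\in\mathfrak h^*$ be given by $\omega_i(h_j)=\delta_{i,j}$. Give $\mathfrak{sl}_n\otimes A$ the bracket $[z\otimes a,w\otimes b]=[z,w]\otimes ab$ and let $U=U(\mathfrak{sl}_n\otimes A)$ be its universal enveloping algebra. For a dominant integral weight $\lambda$, the global Weyl module $W_A(\lambda)$ is the left $U$-module generated by a vector $w_\lambda$ with defining relations $$(x\otimes a)w_\lambda=0,\qquad (h\otimes 1)w_\lambda=\lambda(h)w_\lambda,\qquad (x_{-i}\otimes 1)^{\lambda(h_i)+1}w_\lambda=0$$ for all $x\in\mathfrak n^+$, $a\in A$, $h\in\mathfrak h$, $1\le i\le n-1$. For $S\subseteq A$ let $\mathcal F(S)$ be the set of finitely supported functions $A\to\mathbb Z_{\ge0}$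 (multisets) with support in $S$, and $\mathcal F=\mathcal F(A)$. For $\psi\in\mathcal F$ put $|\psi|=\sum_a\psi(a)$, $\pi(\psi)=\prod_a a^{\psi(a)}$ and $\mathcal M(\psi)=|\psi|!/\prod_a\psi(a)!$; write $\psi\subseteq\chi$ if $\psi(a)\le\chi(a)$ for all $a$, and let $\chi_d$ be the characteristic function of $\{d\}$. For $1\le i\le n-1$ and $\varphi,\chi\in\mathcal F$ define $q_i(\varphi,\chi)\in U$ recursively by $q_i(0,0)=1$, $$q_i(0,\chi)=-\frac1{|\chi|}\sum_{0\ne\psi\subseteq\chi}\mathcal M(\psi)\,(h_i\otimes\pi(\psi))\,q_i(0,\chi-\psi)\qquad(\chi\neq0),$$ $$q_i(\varphi,\chi)=-\frac1{|\varphi|}\sum_{\psi\subseteq\chi}\ \sum_{d\in\operatorname{supp}\varphi}\mathcal M(\psi)\,(x_{-i}\otimes d\,\pi(\psi))\,q_i(\varphi-\chi_d,\chi-\psi)\qquad(\varphi\ne0),$$ and for $\varphi_1,\dots,\varphi_n\in\mathcal F$ put $$q(\varphi_1,\dots,\varphi_n)=q_{n-1}(\varphi_n,\varphi_{n-1})\;q_{n-2}\Big(\big(|\varphi_{n-1}|+|\varphi_n|\big)\chi_1,\varphi_{n-2}\Big)\cdots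 q_1\Big(\Big(\sum_{j=2}^n|\varphi_j|\Big)\chi_1,\varphi_1\Big),$$ where $\chi_1$ is the characteristic function of $\{1\}$, $1$ being the unit of $A$ (for $n=2$, $q(\varphi_1,\varphi_2)=q_1(\varphi_2,\varphi_1)$). **Theorem.** Let $\mathcal B$ be a basis of the complex vector space $A$ and let $m\in\mathbb Z_{>0}$. Then the family of vectors $$q(\varphi_1,\dots,\varphi_n)\,w_{m\omega_1},\qquad \varphi_1,\dots,\varphi_n\in\mathcal F(\mathcal B),\quad \sum_{i=1}^n|\varphi_i|=m,$$ is a basis of the complex vector space $W_A(m\omega_1)$. -/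

import Mathlib

open scoped TensorProduct

noncomputable section

namespace GlobalWeyl

/-! ### The Lie algebra `sl_n`

Matrix indices are `Fin n`, simple-root indices are `Fin (n - 1)`; both start at `0`. -/

/-- The Lie algebra of traceless complex `n × n` matrices. -/
abbrev Sl (n : ℕ) : Type := LieAlgebra.SpecialLinear.sl (Fin n) ℂ

/-- The matrix index `i` attached to the simple root `α_i = ε_i - ε_{i+1}`. -/
def lo {n : ℕ} (i : Fin (n - 1)) : Fin n := ⟨i, by omega⟩

/-- The matrix index `i + 1` attached to the simple root `α_i = ε_i - ε_{i+1}`. -/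
def hi {n : ℕ} (i : Fin (n - 1)) : Fin n := ⟨i + 1, by omega⟩

theorem lo_lt_hi {n : ℕ} (i : Fin (n - 1)) : lo i < hi i :=
  Fin.mk_lt_mk.mpr (Nat.lt_succ_self _)

/-- `h_i = e_{i,i} - e_{i+1,i+1}`. -/
def hElt {n : ℕ} (i : Fin (n - 1)) : Sl n :=
  LieAlgebra.SpecialLinear.singleSubSingle (lo i) (hi i) (1 : ℂ)

/-- `x_{-i} = e_{i+1,i}`. -/
def xNeg {n : ℕ} (i : Fin (n - 1)) : Sl n :=
  LieAlgebra.SpecialLinear.single (hi i) (lo i) (lo_lt_hi i).ne' (1 : ℂ)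

/-- `𝔫⁺`, the span of the `e_{i,j}` with `i < j`. -/
def nPos (n : ℕ) : Submodule ℂ (Sl n) :=
  Submodule.span ℂ {x | ∃ (i j : Fin n) (hij : i < j),
    x = LieAlgebra.SpecialLinear.single i j hij.ne (1 : ℂ)}

/-- The Cartan subalgebra `𝔥`, the span of the `h_i`. -/
def cartan (n : ℕ) : Submodule ℂ (Sl n) :=
  Submodule.span ℂ (Set.range (hElt (n := n)))

theorem hElt_mem_cartan {n : ℕ} (i : Fin (n - 1)) : hElt i ∈ cartan n :=
  Submodule.subset_span ⟨i, rfl⟩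

/-- The fundamental weight `ω_i = ε_1 + ⋯ + ε_i ∈ 𝔥*`. -/
def fundamentalWeight {n : ℕ} (i : Fin (n - 1)) : Module.Dual ℂ (cartan n) where
  toFun h := ∑ k ∈ Finset.Iic (lo i), (h : Sl n).val k k
  map_add' x y := by simp [Finset.sum_add_distrib]
  map_smul' c x := by simp [Finset.mul_sum]

/-- The fundamental weights are characterised by `ω_i(h_j) = δ_{ij}`. -/
theorem fundamentalWeight_hElt {n : ℕ} (i j : Fin (n - 1)) :
    fundamentalWeight i ⟨hElt j, hElt_mem_cartan j⟩ = if i = j then 1 else 0 := by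
  have h1 : ∀ a : Fin n, (∑ k ∈ Finset.Iic (lo i), (if a = k then (1 : ℂ) else 0)) =
      if a ≤ lo i then 1 else 0 := by
    intro a
    simp [Finset.sum_ite_eq]
  have h2 : ∀ a k : Fin n, Matrix.single a a (1 : ℂ) k k = if a = k then 1 else 0 := by
    intro a k
    simp [Matrix.single_apply]
  show (∑ k ∈ Finset.Iic (lo i), (hElt j).val k k) = _
  simp only [hElt, LieAlgebra.SpecialLinear.val_singleSubSingle, Matrix.sub_apply, h2,
    Finset.sum_sub_distrib, h1]
  simp only [lo, hi, Fin.mk_le_mk, Fin.ext_iff]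
  split_ifs <;> first | omega | simp

/-- The dominant integral weight `∑ i, c i • ω_i`, given by its coefficients `c i ∈ ℕ`. -/
def dominantWeight {n : ℕ} (c : Fin (n - 1) → ℕ) : Module.Dual ℂ (cartan n) :=
  ∑ i, c i • fundamentalWeight i

theorem dominantWeight_hElt {n : ℕ} (c : Fin (n - 1) → ℕ) (j : Fin (n - 1)) :
    dominantWeight c ⟨hElt j, hElt_mem_cartan j⟩ = c j := by
  simp [dominantWeight, LinearMap.sum_apply, fundamentalWeight_hElt]

/-- The coefficients of the weight `m • ω_1`. -/
def mulOmegaOne (n m : ℕ) : Fin (n - 1) → ℕ := fun i => if (i : ℕ) = 0 then m else 0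

theorem degree_sub_lt {S : Type*} {χ ψ : S →₀ ℕ} (h : ψ ≤ χ) (h0 : ψ ≠ 0) :
    (χ - ψ).degree < χ.degree := by
  have h1 : (χ - ψ).degree + ψ.degree = χ.degree := by
    rw [← map_add, tsub_add_cancel_of_le h]
  have h2 : ψ.degree ≠ 0 := fun h => h0 ((Finsupp.degree_eq_zero_iff ψ).mp h)
  omega

theorem single_one_le {S : Type*} {φ : S →₀ ℕ} {d : S} (h : d ∈ φ.support) : Finsupp.single d 1 ≤ φ :=
  Finsupp.single_le_iff.mpr (Nat.one_le_iff_ne_zero.mpr (Finsupp.mem_support_iff.mp h))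

/-! ### The map algebra and the global Weyl module -/

variable {n : ℕ} {A : Type*} [CommRing A] [Algebra ℂ A]

/-- The universal enveloping algebra of the map algebra `sl_n ⊗ A`, whose bracket is
`[a ⊗ z, b ⊗ w] = ab ⊗ [z, w]` (the factor `A` is written on the left). -/
abbrev UMap (n : ℕ) (A : Type*) [CommRing A] [Algebra ℂ A] : Type _ :=
  UniversalEnvelopingAlgebra ℂ (A ⊗[ℂ] Sl n)

/-- The element `z ⊗ a` of `sl_n ⊗ A`, viewed in the enveloping algebra. -/
def el (z : Sl n) (a : A) : UMap n A :=
  UniversalEnvelopingAlgebra.ι ℂ (a ⊗ₜ[ℂ] z : A ⊗[ℂ] Sl n)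

/-- The left ideal generated by the defining relations of the global Weyl module of highest
weight `λ = ∑ i, c i • ω_i`: the elements `x ⊗ a` (`x ∈ 𝔫⁺`, `a ∈ A`), `h ⊗ 1 - λ(h)`
(`h ∈ 𝔥`) and `(x_{-i} ⊗ 1)^{λ(h_i) + 1}`. -/
def weylIdeal (n : ℕ) (A : Type*) [CommRing A] [Algebra ℂ A] (c : Fin (n - 1) → ℕ) :
    Submodule (UMap n A) (UMap n A) :=
  Submodule.span (UMap n A)
    ({u | ∃ x ∈ nPos n, ∃ a : A, u = el x a} ∪
     {u | ∃ h : cartan n,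
        u = el (h : Sl n) (1 : A) - algebraMap ℂ (UMap n A) (dominantWeight c h)} ∪
     {u | ∃ i : Fin (n - 1), u = el (xNeg i) (1 : A) ^ (c i + 1)})

/-- The global Weyl module `W_A(λ)` of highest weight `λ = ∑ i, c i • ω_i`. -/
abbrev WeylModule (n : ℕ) (A : Type*) [CommRing A] [Algebra ℂ A] (c : Fin (n - 1) → ℕ) :
    Type _ :=
  UMap n A ⧸ weylIdeal n A c

/-- The highest weight vector `w_λ`. -/
def highestWeightVector (n : ℕ) (A : Type*) [CommRing A] [Algebra ℂ A]
    (c : Fin (n - 1) → ℕ) : WeylModule n A c :=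
  Submodule.Quotient.mk 1

/-! ### The elements `q_i(φ, χ)` and `q(φ_1, …, φ_n)`

A finitely supported multiset `χ` on `A` is an element of `A →₀ ℕ`, with size `|χ| = χ.degree`;
its sub-multisets are the elements of `Finset.Icc 0 χ`, and `ψ.multinomial = |ψ|! / ∏ ψ(a)!`. -/

/-- `π(ψ) = ∏ a, a ^ ψ(a)`. -/
def prodOf (ψ : A →₀ ℕ) : A := ψ.prod fun a k => a ^ k

open Classical in
/-- The elements `q_i(0, χ)`. -/
def qZero (i : Fin (n - 1)) (χ : A →₀ ℕ) : UMap n A :=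
  if χ = 0 then 1
  else -((χ.degree : ℂ)⁻¹ • ∑ ψ ∈ ((Finset.Icc 0 χ).erase 0).attach,
    (ψ.1.multinomial : ℂ) • (el (hElt i) (prodOf ψ.1) * qZero i (χ - ψ.1)))
termination_by χ.degree
decreasing_by
  exact degree_sub_lt (Finset.mem_Icc.mp (Finset.mem_of_mem_erase ψ.2)).2
    (Finset.ne_of_mem_erase ψ.2)

open Classical in
/-- The elements `q_i(φ, χ)`. -/
def qElt (i : Fin (n - 1)) (φ χ : A →₀ ℕ) : UMap n A :=
  if φ = 0 then qZero i χ
  else -((φ.degree : ℂ)⁻¹ • ∑ ψ ∈ Finset.Icc 0 χ, ∑ d ∈ φ.support.attach,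
    (ψ.multinomial : ℂ) • (el (xNeg i) (d.1 * prodOf ψ) *
      qElt i (φ - Finsupp.single d.1 1) (χ - ψ)))
termination_by φ.degree
decreasing_by
  exact degree_sub_lt (single_one_le d.2) (by simp)

/-! The recursion for `q_i` in unfolded form. -/

theorem qElt_zero_zero (i : Fin (n - 1)) : qElt i (0 : A →₀ ℕ) 0 = 1 := by
  rw [qElt, if_pos rfl, qZero, if_pos rfl]

open Classical in
theorem qElt_zero_left (i : Fin (n - 1)) {χ : A →₀ ℕ} (h : χ ≠ 0) :
    qElt i 0 χ = -((χ.degree : ℂ)⁻¹ • ∑ ψ ∈ (Finset.Icc 0 χ).erase 0,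
      (ψ.multinomial : ℂ) • (el (hElt i) (prodOf ψ) * qElt i 0 (χ - ψ))) := by
  have h0 : ∀ χ' : A →₀ ℕ, qElt i 0 χ' = qZero i χ' := fun χ' => by rw [qElt, if_pos rfl]
  simp only [h0]
  rw [qZero, if_neg h]
  congr 2
  exact Finset.sum_attach ((Finset.Icc 0 χ).erase 0) fun ψ =>
    (ψ.multinomial : ℂ) • (el (hElt i) (prodOf ψ) * qZero i (χ - ψ))

open Classical in
theorem qElt_of_ne_zero (i : Fin (n - 1)) {φ : A →₀ ℕ} (χ : A →₀ ℕ) (h : φ ≠ 0) :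
    qElt i φ χ = -((φ.degree : ℂ)⁻¹ • ∑ ψ ∈ Finset.Icc 0 χ, ∑ d ∈ φ.support,
      (ψ.multinomial : ℂ) • (el (xNeg i) (d * prodOf ψ) *
        qElt i (φ - Finsupp.single d 1) (χ - ψ))) := by
  rw [qElt, if_neg h]
  congr 2
  refine Finset.sum_congr rfl fun ψ _ => ?_
  exact Finset.sum_attach φ.support fun d =>
    (ψ.multinomial : ℂ) • (el (xNeg i) (d * prodOf ψ) *
      qElt i (φ - Finsupp.single d 1) (χ - ψ))

/-- The `i`-th factor of `q(φ_1, …, φ_n)`: it is `q_{n-1}(φ_n, φ_{n-1})` for the last index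
`i = n - 1`, and `q_i((∑_{j > i} |φ_j|) χ_1, φ_i)` for `i < n - 1`, where `χ_1` is the
characteristic function of the unit of `A`. -/
def qFactor (φ : Fin n → A →₀ ℕ) (i : Fin (n - 1)) : UMap n A :=
  if (i : ℕ) + 2 = n then qElt i (φ (hi i)) (φ (lo i))
  else qElt i ((∑ j ∈ Finset.Ioi (lo i), (φ j).degree) • Finsupp.single 1 1) (φ (lo i))

/-- `q(φ_1, …, φ_n)`, the product of the factors with the largest index on the left. -/
def qProd (φ : Fin n → A →₀ ℕ) : UMap n A :=
  ((List.finRange (n - 1)).reverse.map (qFactor φ)).prod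

/-- The tuples `(φ_1, …, φ_n)` of finitely supported multisets on `B ⊆ A` of total size `m`. -/
abbrev Tuples (n : ℕ) (B : Set A) (m : ℕ) : Type _ :=
  {φ : Fin n → A →₀ ℕ // (∀ i, ((φ i).support : Set A) ⊆ B) ∧ ∑ i, (φ i).degree = m}

end GlobalWeyl

end

/-! The module `W_A(m ω_1)` is the `m`-th symmetric power of `ℂⁿ ⊗ A`, with the highest weight
vector `w` in the role of `(e_1 ⊗ 1)^m`. In this model `q(φ_1, …, φ_n) w` is a nonzero multiple of
`∏_j ∏_b (e_j ⊗ b)^{φ_j(b)}`. When the `φ_j` run over multisets on a basis of `A`, of total size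
`m`, these products are exactly the monomials of degree `m`, each occurring once.

The symmetric algebra is a polynomial ring on which `x ⊗ a` acts by the derivation `mapDer`. Since
`(e_1 ⊗ 1)^m` satisfies the defining relations, it is the image of `w` under a homomorphism `Ψ`
(`exists_weylModule_toPoly`).

The main point is that `Ψ` is injective. The action on the Weyl module extends to `gl_n ⊗ A`,
because right multiplication by `h_1 ⊗ a` is well defined (`exists_gl_action`). With this extension
`w` is killed by every `e_{i,j} ⊗ a` with `j ≠ 1`. An equivariant map `E` back to the Weyl module is
then built by the recursion `F_{k+1}(v f) = v F_k(f) - F_k(v f)` for `v = e_j ⊗ a` acting as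
`e_{j,1} ⊗ a` (`symEval`). The relation `(x_{-1} ⊗ 1)^{m+1} w = 0` forces `F_{m+1} = 0`, and this
says that `E = F_m` is equivariant for the remaining `e_{j,1} ⊗ a`. So `E ∘ Ψ` is a nonzero scalar.

The image of `q(φ_1, …, φ_n) w` is computed from the recursion for `q_i`: the sums over submultisets
telescope (`sum_multinomial_smul_derivation`), which gives the closed formula `polyAction_qElt`. -/

noncomputable section

namespace GlobalWeyl

/-! ### The polynomial representation of `gl_n ⊗ A` -/

section PolynomialRepresentation

variable {n : ℕ} {A : Type*} [CommRing A] [Algebra ℂ A] {κ : Type*} (bas : Module.Basis κ ℂ A)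

/-- The symmetric algebra of `ℂⁿ ⊗ A`, realised as a polynomial ring through a basis of `A`. -/
abbrev PolyRep (n : ℕ) (κ : Type*) : Type _ := MvPolynomial (Fin n × κ) ℂ

/-- The linear form `e_j ⊗ a`. -/
def linForm (j : Fin n) : A →ₗ[ℂ] PolyRep n κ :=
  bas.constr ℂ fun k => MvPolynomial.X (j, k)

@[simp] theorem linForm_basis (j : Fin n) (k : κ) :
    linForm bas j (bas k) = MvPolynomial.X (j, k) := by
  simp [linForm]

/-- The derivation by which `x ⊗ a` acts on the symmetric algebra of `ℂⁿ ⊗ A`. -/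
def mapDer : A →ₗ[ℂ] Matrix (Fin n) (Fin n) ℂ →ₗ[ℂ]
    Derivation ℂ (PolyRep n κ) (PolyRep n κ) :=
  LinearMap.mk₂ ℂ
    (fun a x => MvPolynomial.mkDerivation ℂ
      fun p => ∑ i, x i p.1 • linForm bas i (a * bas p.2))
    (fun a a' x => MvPolynomial.derivation_ext fun p => by
      simp [MvPolynomial.mkDerivation_X, add_mul, Finset.sum_add_distrib])
    (fun c a x => MvPolynomial.derivation_ext fun p => by
      simp [MvPolynomial.mkDerivation_X, Finset.smul_sum, smul_comm c])
    (fun a x y => MvPolynomial.derivation_ext fun p => by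
      simp [MvPolynomial.mkDerivation_X, add_smul, Finset.sum_add_distrib])
    (fun c a x => MvPolynomial.derivation_ext fun p => by
      simp [MvPolynomial.mkDerivation_X, Finset.smul_sum, mul_smul])

theorem mapDer_linForm (a : A) (x : Matrix (Fin n) (Fin n) ℂ) (j : Fin n) (b : A) :
    mapDer bas a x (linForm bas j b) = ∑ i, x i j • linForm bas i (a * b) := by
  have : (mapDer bas a x).toLinearMap ∘ₗ linForm bas j =
      ∑ i, x i j • (linForm bas i ∘ₗ LinearMap.mulLeft ℂ a) := bas.ext fun k => by
    simp [mapDer, MvPolynomial.mkDerivation_X, LinearMap.sum_apply]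
  simpa [LinearMap.sum_apply] using LinearMap.congr_fun this b

theorem mapDer_X (a : A) (x : Matrix (Fin n) (Fin n) ℂ) (j : Fin n) (k : κ) :
    mapDer bas a x (MvPolynomial.X (j, k)) = ∑ i, x i j • linForm bas i (a * bas k) := by
  rw [← linForm_basis bas, mapDer_linForm]

theorem mapDer_single_linForm (a : A) (i j p : Fin n) (b : A) :
    mapDer bas a (Matrix.single i j 1) (linForm bas p b) =
      if j = p then linForm bas i (a * b) else 0 := by
  rw [mapDer_linForm]
  split_ifs with h
  · subst h
    rw [Finset.sum_eq_single i] <;> simp +contextual [eq_comm]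
  · simp [h]

/-- Both sides are derivations, so it suffices to compare them on the variables, where only the
matrix product and the commutativity of `A` enter. -/
theorem mapDer_comm (a b : A) (x y : Matrix (Fin n) (Fin n) ℂ) (f : PolyRep n κ) :
    mapDer bas a x (mapDer bas b y f) - mapDer bas b y (mapDer bas a x f) =
      mapDer bas (a * b) (x * y - y * x) f := by
  rw [← Derivation.commutator_apply]
  congr 1
  refine MvPolynomial.derivation_ext fun p => ?_
  obtain ⟨j, k⟩ := p
  rw [Derivation.commutator_apply, mapDer_X, mapDer_X, mapDer_X]
  simp only [map_sum, Derivation.map_smul, mapDer_linForm, Finset.smul_sum, Matrix.sub_apply, sub_smul,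
    Finset.sum_sub_distrib, Matrix.mul_apply, Finset.sum_smul, smul_smul]
  refine congrArg₂ (fun p q : PolyRep n κ => p - q) ?_ ?_
  · rw [Finset.sum_comm]
    refine Finset.sum_congr rfl fun i _ => Finset.sum_congr rfl fun l _ => ?_
    rw [mul_comm (y l j), mul_assoc]
  · rw [Finset.sum_comm]
    refine Finset.sum_congr rfl fun i _ => Finset.sum_congr rfl fun l _ => ?_
    rw [mul_comm (x l j), mul_left_comm b, mul_assoc]

theorem linForm_isHomogeneous (j : Fin n) (a : A) : (linForm bas j a).IsHomogeneous 1 := by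
  have : linForm bas j a ∈ MvPolynomial.homogeneousSubmodule (Fin n × κ) ℂ 1 := by
    rw [linForm, Module.Basis.constr_apply]
    exact Submodule.sum_mem _ fun k _ => Submodule.smul_mem _ _ (MvPolynomial.isHomogeneous_X _ _)
  exact this

/-- A form of degree `d + 1` is a sum of products of a linear form with a form of degree `d`, so the
Leibniz rule reduces the claim to variables. -/
theorem mapDer_isHomogeneous (a : A) (x : Matrix (Fin n) (Fin n) ℂ) {f : PolyRep n κ} {d : ℕ}
    (hf : f.IsHomogeneous d) : (mapDer bas a x f).IsHomogeneous d := by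
  induction d generalizing f with
  | zero =>
    rw [← MvPolynomial.totalDegree_zero_iff_isHomogeneous,
      MvPolynomial.totalDegree_eq_zero_iff_eq_C] at hf
    rw [hf, MvPolynomial.derivation_C]
    exact MvPolynomial.isHomogeneous_zero _ _ _
  | succ d ih =>
    rw [← MvPolynomial.mem_homogeneousSubmodule, ← MvPolynomial.homogeneousSubmodule_one_pow,
      pow_succ', MvPolynomial.homogeneousSubmodule_one_pow] at hf
    induction hf using Submodule.mul_induction_on' with
    | mem_mul_mem p hp q hq =>
      rw [Derivation.leibniz, smul_eq_mul, smul_eq_mul]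
      have hp' : (mapDer bas a x p).IsHomogeneous 1 := by
        rw [MvPolynomial.homogeneousSubmodule_one_eq_span_X] at hp
        induction hp using Submodule.span_induction with
        | mem p hp =>
          obtain ⟨⟨j, k⟩, rfl⟩ := hp
          rw [mapDer_X]
          exact Submodule.sum_mem (MvPolynomial.homogeneousSubmodule _ ℂ 1) fun i _ =>
            Submodule.smul_mem _ _ (linForm_isHomogeneous bas i _)
        | zero => rw [map_zero]; exact MvPolynomial.isHomogeneous_zero _ _ _
        | add p q _ _ hp hq => rw [map_add]; exact hp.add hq
        | smul c p _ hp =>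
          rw [Derivation.map_smul]
          exact Submodule.smul_mem (MvPolynomial.homogeneousSubmodule _ ℂ 1) c hp
      refine MvPolynomial.IsHomogeneous.add ?_ ?_
      · rw [add_comm d 1]; exact MvPolynomial.IsHomogeneous.mul hp (ih hq)
      · exact MvPolynomial.IsHomogeneous.mul hq hp'
    | add p _ q _ hp hq => rw [map_add]; exact hp.add hq

end PolynomialRepresentation

/-! ### Maps from the symmetric algebra to a highest weight representation of `gl_n ⊗ A` -/

section SymEval

variable {n : ℕ} {A : Type*} [CommRing A] [Algebra ℂ A] {κ : Type*} (bas : Module.Basis κ ℂ A)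
  {W : Type*} [AddCommGroup W] [Module ℂ W]
  (ρ : A →ₗ[ℂ] Matrix (Fin n) (Fin n) ℂ →ₗ[ℂ] Module.End ℂ W) (w : W) (o : Fin n)

theorem single_mul_single_ite (i j k l : Fin n) :
    (Matrix.single i j 1 * Matrix.single k l 1 : Matrix (Fin n) (Fin n) ℂ) =
      if j = k then Matrix.single i l 1 else 0 := by
  split_ifs with h
  · subst h; simp
  · simp [h]

/-- The action of `e_{j,o} ⊗ a` on linear maps from the symmetric algebra to `W`. -/
def homAct (j : Fin n) (a : A) (F : PolyRep n κ →ₗ[ℂ] W) : PolyRep n κ →ₗ[ℂ] W :=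
  ρ a (Matrix.single j o 1) ∘ₗ F - F ∘ₗ (mapDer bas a (Matrix.single j o 1)).toLinearMap

theorem homAct_apply (j : Fin n) (a : A) (F : PolyRep n κ →ₗ[ℂ] W) (f : PolyRep n κ) :
    homAct bas ρ o j a F f =
      ρ a (Matrix.single j o 1) (F f) - F (mapDer bas a (Matrix.single j o 1) f) := rfl

/-- The degree `k` part of the linear map which sends `v_1 ⋯ v_k` to the symmetrised action of
`v_1, …, v_k` on `w`, where `v = e_j ⊗ a` acts as `e_{j,o} ⊗ a`. -/
def symEval : ℕ → PolyRep n κ →ₗ[ℂ] W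
  | 0 => (MvPolynomial.lcoeff ℂ 0).smulRight w
  | k + 1 => (MvPolynomial.basisMonomials (Fin n × κ) ℂ).constr ℂ fun d =>
      open Classical in
      if h : d = 0 then 0 else
        -- An arbitrary variable is split off the monomial; `symEval_linForm_mul` shows that the
        -- choice is irrelevant.
        let p := (Finsupp.support_nonempty_iff.mpr h).choose
        homAct bas ρ o p.1 (bas p.2) (symEval k)
          (MvPolynomial.monomial (d - Finsupp.single p 1) 1)

theorem symEval_zero (f : PolyRep n κ) :
    symEval bas ρ w o 0 f = MvPolynomial.coeff 0 f • w := rfl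

theorem symEval_succ_one (k : ℕ) : symEval bas ρ w o (k + 1) 1 = 0 := by
  have := (MvPolynomial.basisMonomials (Fin n × κ) ℂ).constr_basis ℂ (fun d =>
      open Classical in
      if h : d = 0 then 0 else
        let p := (Finsupp.support_nonempty_iff.mpr h).choose
        homAct bas ρ o p.1 (bas p.2) (symEval bas ρ w o k)
          (MvPolynomial.monomial (d - Finsupp.single p 1) 1)) 0
  rw [dif_pos rfl] at this
  simpa [symEval] using this

theorem exists_symEval_monomial (k : ℕ) {d : Fin n × κ →₀ ℕ} (h : d ≠ 0) :
    ∃ (p : Fin n × κ) (g : Fin n × κ →₀ ℕ), d = Finsupp.single p 1 + g ∧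
      symEval bas ρ w o (k + 1) (MvPolynomial.monomial d 1) =
        homAct bas ρ o p.1 (bas p.2) (symEval bas ρ w o k) (MvPolynomial.monomial g 1) := by
  have := (MvPolynomial.basisMonomials (Fin n × κ) ℂ).constr_basis ℂ (fun d =>
      open Classical in
      if h : d = 0 then 0 else
        let p := (Finsupp.support_nonempty_iff.mpr h).choose
        homAct bas ρ o p.1 (bas p.2) (symEval bas ρ w o k)
          (MvPolynomial.monomial (d - Finsupp.single p 1) 1)) d
  rw [dif_neg h] at this
  refine ⟨_, _, ?_, by simpa [symEval] using this⟩
  exact (add_tsub_cancel_of_le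
    (single_one_le (Finsupp.support_nonempty_iff.mpr h).choose_spec)).symm

variable {ρ}

theorem coeff_zero_mapDer (a : A) (x : Matrix (Fin n) (Fin n) ℂ) (f : PolyRep n κ) :
    MvPolynomial.coeff 0 (mapDer bas a x f) = 0 := by
  induction f using MvPolynomial.induction_on with
  | C c => simp
  | add p q hp hq => simp [hp, hq]
  | mul_X p q hp =>
    have h0 : MvPolynomial.constantCoeff (mapDer bas a x (MvPolynomial.X q)) = 0 := by
      rw [mapDer_X, map_sum]
      refine Finset.sum_eq_zero fun i _ => ?_
      rw [MvPolynomial.constantCoeff_eq, MvPolynomial.coeff_smul,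
        (linForm_isHomogeneous bas i _).coeff_eq_zero (by simp), smul_zero]
    rw [← MvPolynomial.constantCoeff_eq] at hp ⊢
    simp [hp, h0]

variable (hρ : ∀ (a b : A) (x y : Matrix (Fin n) (Fin n) ℂ) (v : W),
  ρ a x (ρ b y v) - ρ b y (ρ a x v) = ρ (a * b) (x * y - y * x) v)
include hρ

/-- After expansion, the asymmetry is the commutator `δ_{oq} e_{p,o} - δ_{op} e_{q,o}` acting on
`F`, and the Leibniz terms of `mapDer` on the linear factor cancel it. This symmetry makes the next
step of the recursion independent of the variable split off. -/
theorem homAct_symm {k : ℕ}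
    (ih : ∀ (j : Fin n) (a : A) (f : PolyRep n κ), symEval bas ρ w o (k + 1) (linForm bas j a * f) =
      homAct bas ρ o j a (symEval bas ρ w o k) f)
    (p q : Fin n) (a b : A) (f : PolyRep n κ) :
    homAct bas ρ o p a (symEval bas ρ w o (k + 1)) (linForm bas q b * f) =
      homAct bas ρ o q b (symEval bas ρ w o (k + 1)) (linForm bas p a * f) := by
  set F := symEval bas ρ w o k with hF
  have key : ∀ (p q : Fin n) (a b : A),
      homAct bas ρ o p a (symEval bas ρ w o (k + 1)) (linForm bas q b * f) =
      ρ a (Matrix.single p o 1) (ρ b (Matrix.single q o 1) (F f))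
      - ρ a (Matrix.single p o 1) (F (mapDer bas b (Matrix.single q o 1) f))
      - ρ b (Matrix.single q o 1) (F (mapDer bas a (Matrix.single p o 1) f))
      + F (mapDer bas b (Matrix.single q o 1) (mapDer bas a (Matrix.single p o 1) f))
      - (if o = q then homAct bas ρ o p (a * b) F f else 0) := by
    intro p q a b
    rw [homAct_apply, ih, Derivation.leibniz, smul_eq_mul, smul_eq_mul, map_add, ih,
      mapDer_single_linForm, mul_ite, mul_zero, mul_comm f, apply_ite (symEval bas ρ w o (k + 1)),
      ih, map_zero, homAct_apply, homAct_apply, map_sub]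
    abel
  rw [key, key, ← sub_eq_zero]
  have h1 := hρ a b (Matrix.single p o 1) (Matrix.single q o 1) (F f)
  have h2 := congrArg F (mapDer_comm bas a b (Matrix.single p o 1) (Matrix.single q o 1) f)
  rw [map_sub] at h2
  rw [sub_eq_iff_eq_add] at h1 h2
  rw [h1, h2, mul_comm b a, single_mul_single_ite, single_mul_single_ite]
  split_ifs <;>
    simp only [homAct_apply, map_sub, LinearMap.sub_apply, Derivation.sub_apply, map_zero,
      LinearMap.zero_apply, Derivation.zero_apply] <;>
    abel

/-- The recursion for `symEval`, freed from the choice of a variable and valid for every linear form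
`e_j ⊗ a`. -/
theorem symEval_linForm_mul (k : ℕ) (j : Fin n) (a : A) (f : PolyRep n κ) :
    symEval bas ρ w o (k + 1) (linForm bas j a * f) =
      homAct bas ρ o j a (symEval bas ρ w o k) f := by
  have lin : ∀ k, (∀ (j : Fin n) (c : κ) (d : Fin n × κ →₀ ℕ),
      symEval bas ρ w o (k + 1) (MvPolynomial.X (j, c) * MvPolynomial.monomial d 1) =
        homAct bas ρ o j (bas c) (symEval bas ρ w o k) (MvPolynomial.monomial d 1)) →
      ∀ (j : Fin n) (a : A) (f : PolyRep n κ), symEval bas ρ w o (k + 1) (linForm bas j a * f) =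
        homAct bas ρ o j a (symEval bas ρ w o k) f := by
    intro k h j a f
    let Φ : A →ₗ[ℂ] PolyRep n κ →ₗ[ℂ] W := LinearMap.mk₂ ℂ
      (fun a f => symEval bas ρ w o (k + 1) (linForm bas j a * f))
      (by simp [add_mul]) (by simp) (by simp [mul_add]) (by simp)
    let Ψ : A →ₗ[ℂ] PolyRep n κ →ₗ[ℂ] W := LinearMap.mk₂ ℂ
      (fun a f => homAct bas ρ o j a (symEval bas ρ w o k) f)
      (by intros; simp [homAct_apply]; abel) (by intros; simp [homAct_apply, smul_sub])
      (by intros; simp) (by intros; simp)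
    have : Φ = Ψ := by
      refine bas.ext fun c => (MvPolynomial.basisMonomials (Fin n × κ) ℂ).ext fun d => ?_
      simpa [Φ, Ψ] using h j c d
    exact LinearMap.congr_fun (LinearMap.congr_fun this a) f
  have main : ∀ k, (∀ (p q : Fin n) (a b : A) (f : PolyRep n κ),
      homAct bas ρ o p a (symEval bas ρ w o k) (linForm bas q b * f) =
        homAct bas ρ o q b (symEval bas ρ w o k) (linForm bas p a * f)) →
      (∀ (j : Fin n) (c : κ) (d : Fin n × κ →₀ ℕ),
      symEval bas ρ w o (k + 1) (MvPolynomial.X (j, c) * MvPolynomial.monomial d 1) =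
        homAct bas ρ o j (bas c) (symEval bas ρ w o k) (MvPolynomial.monomial d 1)) := by
    intro k h j c d
    obtain ⟨⟨p, b⟩, g, hg, he⟩ := exists_symEval_monomial bas ρ w o k
      (d := Finsupp.single (j, c) 1 + d) (by simp)
    rw [MvPolynomial.X, MvPolynomial.monomial_mul, one_mul, he]
    by_cases hpj : (p, b) = (j, c)
    · rw [hpj] at hg
      rw [← add_left_cancel hg]
      cases hpj; rfl
    -- If the variable split off is not `X (j, c)`, the monomial is divisible by the product of the
    -- two, and the symmetry `h` exchanges them.
    · have hd : Finsupp.single (p, b) 1 ≤ d := by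
        classical
        rw [Finsupp.single_le_iff]
        have := DFunLike.congr_fun hg (p, b)
        simp [Ne.symm hpj] at this
        simp; omega
      obtain ⟨e, rfl⟩ := exists_add_of_le hd
      have hge : g = Finsupp.single (j, c) 1 + e := by
        rw [add_left_comm] at hg
        exact (add_left_cancel hg).symm
      have h3 := h p j (bas b) (bas c) (MvPolynomial.monomial e 1)
      rw [linForm_basis, linForm_basis, MvPolynomial.X, MvPolynomial.X,
        MvPolynomial.monomial_mul, MvPolynomial.monomial_mul, one_mul] at h3
      rw [hge, h3]
  induction k generalizing j a f with
  | zero =>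
    refine lin 0 (main 0 fun p q a b f => ?_) j a f
    have h0 : ∀ (p : Fin n) (a : A) (f : PolyRep n κ),
        MvPolynomial.coeff 0 (linForm bas p a * f) = 0 := by
      intro p a f
      rw [← MvPolynomial.constantCoeff_eq, map_mul, MvPolynomial.constantCoeff_eq,
        (linForm_isHomogeneous bas p a).coeff_eq_zero (by simp), zero_mul]
    simp only [homAct_apply, symEval_zero, h0, coeff_zero_mapDer, zero_smul, map_zero]
  | succ k ih => exact lin _ (main _ (homAct_symm bas w o hρ ih)) j a f

end SymEval

/-! ### Degree, equivariance and vanishing of the symmetrised evaluation -/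

section SymEval

variable {n : ℕ} {A : Type*} [CommRing A] [Algebra ℂ A] {κ : Type*} (bas : Module.Basis κ ℂ A)
  {W : Type*} [AddCommGroup W] [Module ℂ W]
  {ρ : A →ₗ[ℂ] Matrix (Fin n) (Fin n) ℂ →ₗ[ℂ] Module.End ℂ W} (w : W) (o : Fin n)
  (hρ : ∀ (a b : A) (x y : Matrix (Fin n) (Fin n) ℂ) (v : W),
    ρ a x (ρ b y v) - ρ b y (ρ a x v) = ρ (a * b) (x * y - y * x) v)

/-- Each step of the recursion splits off one linear factor, derivations preserve the degree, and
`symEval` at `0` sees only the constant term. -/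
theorem symEval_eq_zero_of_isHomogeneous {k d : ℕ} (hkd : d ≠ k) {f : PolyRep n κ}
    (hf : f.IsHomogeneous d) : symEval bas ρ w o k f = 0 := by
  induction k generalizing d f with
  | zero => rw [symEval_zero, hf.coeff_eq_zero (by simpa using hkd.symm), zero_smul]
  | succ k ih =>
    rw [f.as_sum, map_sum]
    refine Finset.sum_eq_zero fun e he => ?_
    have hd : e.degree = d := by
      by_contra h
      exact MvPolynomial.mem_support_iff.mp he (hf.coeff_eq_zero h)
    rw [← mul_one (MvPolynomial.coeff e f), ← smul_eq_mul, ← MvPolynomial.smul_monomial, map_smul]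
    by_cases h0 : e = 0
    · subst h0
      rw [MvPolynomial.monomial_zero', map_one, symEval_succ_one, smul_zero]
    · obtain ⟨p, g, rfl, he⟩ := exists_symEval_monomial bas ρ w o k h0
      rw [map_add, Finsupp.degree_single] at hd
      have hg : (MvPolynomial.monomial g (1 : ℂ)).IsHomogeneous g.degree :=
        MvPolynomial.isHomogeneous_monomial _ rfl
      rw [he, homAct_apply, ih (by omega) hg, ih (by omega) (mapDer_isHomogeneous bas _ _ hg),
        map_zero, sub_zero, smul_zero]

include hρ

/-- Induction on `k`, splitting a variable off a monomial. In `[e_{i,j}, e_{p,o}] = δ_{jp} e_{i,o} -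
δ_{oi} e_{p,j}` the first term matches the Leibniz term; the second again has column `j ≠ o`, so the
induction hypothesis applies to it. -/
theorem symEval_mapDer_single (hw : ∀ (a : A) (i j : Fin n), j ≠ o → ρ a (Matrix.single i j 1) w = 0)
    (k : ℕ) (a : A) (i j : Fin n) (hj : j ≠ o) (f : PolyRep n κ) :
    symEval bas ρ w o k (mapDer bas a (Matrix.single i j 1) f) =
      ρ a (Matrix.single i j 1) (symEval bas ρ w o k f) := by
  induction k generalizing a i j f with
  | zero =>
    rw [symEval_zero, symEval_zero, coeff_zero_mapDer, map_smul, hw a i j hj, zero_smul, smul_zero]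
  | succ k ih =>
    suffices h : symEval bas ρ w o (k + 1) ∘ₗ (mapDer bas a (Matrix.single i j 1)).toLinearMap =
        ρ a (Matrix.single i j 1) ∘ₗ symEval bas ρ w o (k + 1) from LinearMap.congr_fun h f
    refine (MvPolynomial.basisMonomials (Fin n × κ) ℂ).ext fun d => ?_
    rw [MvPolynomial.coe_basisMonomials]
    simp only [LinearMap.comp_apply, Derivation.coeFn_coe]
    by_cases h0 : d = 0
    · subst h0
      rw [MvPolynomial.monomial_zero', map_one, symEval_succ_one, map_zero, Derivation.map_one_eq_zero,
        map_zero]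
    · obtain ⟨⟨p, c⟩, hp⟩ := Finsupp.support_nonempty_iff.mpr h0
      obtain ⟨g, rfl⟩ := exists_add_of_le (single_one_le hp)
      have hX : MvPolynomial.monomial (Finsupp.single (p, c) 1 + g) (1 : ℂ) =
          linForm bas p (bas c) * MvPolynomial.monomial g 1 := by
        rw [linForm_basis, MvPolynomial.X, MvPolynomial.monomial_mul, one_mul]
      set G := MvPolynomial.monomial g (1 : ℂ)
      set b := bas c
      rw [hX, Derivation.leibniz, smul_eq_mul, smul_eq_mul, map_add,
        symEval_linForm_mul bas w o hρ, symEval_linForm_mul bas w o hρ, mapDer_single_linForm,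
        mul_ite, mul_zero, mul_comm G, apply_ite (symEval bas ρ w o (k + 1)),
        symEval_linForm_mul bas w o hρ]
      simp only [homAct_apply, map_zero, map_sub]
      have h1 := hρ a b (Matrix.single i j 1) (Matrix.single p o 1) (symEval bas ρ w o k G)
      have h2 := congrArg (symEval bas ρ w o k)
        (mapDer_comm bas a b (Matrix.single i j 1) (Matrix.single p o 1) G)
      rw [map_sub] at h2
      rw [sub_eq_iff_eq_add] at h1 h2
      rw [h1, ← ih a i j hj (mapDer bas b _ G), h2, single_mul_single_ite, single_mul_single_ite,
        ← ih a i j hj G]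
      have h3 := ih (a * b) p j hj G
      split_ifs <;>
        simp only [map_sub, LinearMap.sub_apply, Derivation.sub_apply, map_zero,
          LinearMap.zero_apply, Derivation.zero_apply, h3] <;>
        abel

theorem symEval_linForm_pow (j : Fin n) (hj : j ≠ o) (k : ℕ) :
    symEval bas ρ w o k (linForm bas j 1 ^ k) = (ρ 1 (Matrix.single j o 1) ^ k) w := by
  induction k with
  | zero => simp [symEval_zero]
  | succ k ih =>
    rw [pow_succ', symEval_linForm_mul bas w o hρ, homAct_apply, ih, Derivation.leibniz_pow,
      mapDer_single_linForm, if_neg hj.symm, smul_zero, smul_zero, map_zero, sub_zero, pow_succ',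
      Module.End.mul_apply]

/-- Passing from `k` to `k + 1` gives the factor `m - k`, since `e_{o,o} ⊗ 1` acts by `m` on `w` and
by `k` on `(e_o ⊗ 1)^k`. -/
theorem symEval_origin_pow {m : ℕ} (hm : ρ 1 (Matrix.single o o 1) w = (m : ℂ) • w) (k : ℕ) :
    symEval bas ρ w o k (linForm bas o 1 ^ k) = (∏ i ∈ Finset.range k, ((m : ℂ) - i)) • w := by
  induction k with
  | zero => simp [symEval_zero]
  | succ k ih =>
    have h1 : mapDer bas 1 (Matrix.single o o 1) (linForm bas o 1 ^ k) =
        (k : ℂ) • linForm bas o 1 ^ k := by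
      rw [Derivation.leibniz_pow, mapDer_single_linForm, if_pos rfl, mul_one]
      rcases k with _ | k
      · simp
      · rw [Nat.add_sub_cancel, smul_eq_mul, ← pow_succ, Nat.cast_smul_eq_nsmul]
    rw [pow_succ', symEval_linForm_mul bas w o hρ, homAct_apply, h1, map_smul, ih, map_smul, hm,
      Finset.prod_range_succ, smul_smul, smul_smul, ← sub_smul]
    congr 1; ring

variable (hw : ∀ (a : A) (i j : Fin n), j ≠ o → ρ a (Matrix.single i j 1) w = 0)
include hw

/-- The value at `(e_j ⊗ 1)^{m+1}` is `e_{j,o}^{m+1} w = 0`. Applying the `e_{i,j} ⊗ c` replaces the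
factors `e_j ⊗ 1` one at a time by arbitrary variables, so every form of degree `m + 1` is killed.
-/
theorem symEval_eq_zero {m : ℕ} (j : Fin n) (hj : j ≠ o)
    (hx : (ρ 1 (Matrix.single j o 1) ^ (m + 1)) w = 0) : symEval bas ρ w o (m + 1) = 0 := by
  have hX : ∀ q, (linForm bas j 1 ^ q).IsHomogeneous q := fun q => by
    simpa using (linForm_isHomogeneous bas j 1).pow q
  have key : ∀ q ≤ m + 1, ∀ f : PolyRep n κ,
      symEval bas ρ w o (m + 1) (f * linForm bas j 1 ^ (m + 1 - q)) = 0 := by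
    intro q
    induction q with
    | zero =>
      intro _ f
      rw [← MvPolynomial.sum_homogeneousComponent f, Finset.sum_mul, map_sum]
      refine Finset.sum_eq_zero fun d _ => ?_
      by_cases hd : d = 0
      · subst hd
        rw [MvPolynomial.homogeneousComponent_zero, ← MvPolynomial.smul_eq_C_mul, map_smul,
          Nat.sub_zero, symEval_linForm_pow bas w o hρ j hj, hx, smul_zero]
      · exact symEval_eq_zero_of_isHomogeneous bas w o (by omega)
          ((MvPolynomial.homogeneousComponent_isHomogeneous d f).mul (hX _))
    | succ q ih =>
      intro hq f
      have ih := ih (by omega)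
      induction f using MvPolynomial.induction_on with
      | C c =>
        rw [← MvPolynomial.smul_eq_C_mul, map_smul,
          symEval_eq_zero_of_isHomogeneous bas w o (by omega) (hX _), smul_zero]
      | add f g hf hg => rw [add_mul, map_add, hf, hg, add_zero]
      | mul_X f p _ =>
        obtain ⟨i, c⟩ := p
        -- With `N = m + 1 - q`, the derivative of `f (e_j ⊗ 1)^N` is `f' (e_j ⊗ 1)^N + N f X_{i,c}
        -- (e_j ⊗ 1)^{N-1}`; the first term is killed by `ih`, and `N ≠ 0` can be cancelled.
        have h1 := symEval_mapDer_single bas w o hρ hw (m + 1) (bas c) i j hj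
          (f * linForm bas j 1 ^ (m + 1 - q))
        rw [ih, map_zero, Derivation.leibniz, Derivation.leibniz_pow, mapDer_single_linForm,
          if_pos rfl, mul_one, map_add, smul_eq_mul, smul_eq_mul, smul_eq_mul,
          mul_comm (_ ^ _) (mapDer bas _ _ f), ih, add_zero, mul_smul_comm, map_nsmul,
          linForm_basis] at h1
        have h2 : m + 1 - q ≠ 0 := by omega
        rw [← Nat.cast_smul_eq_nsmul ℂ, smul_eq_zero_iff_right (by exact_mod_cast h2)] at h1
        rw [mul_assoc, mul_comm (MvPolynomial.X _), ← h1]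
        rfl
  exact LinearMap.ext fun f => by simpa using key (m + 1) le_rfl f

/-- A highest weight representation of `gl_n ⊗ A` on which `e_{j,o}` is nilpotent of order `m + 1`
is a quotient of the symmetric power of `ℂⁿ ⊗ A`. -/
theorem exists_equivariant_of_highestWeight {m : ℕ} (hm : ρ 1 (Matrix.single o o 1) w = (m : ℂ) • w)
    (j : Fin n) (hj : j ≠ o) (hx : (ρ 1 (Matrix.single j o 1) ^ (m + 1)) w = 0) :
    ∃ E : PolyRep n κ →ₗ[ℂ] W, (∃ c : ℂ, c ≠ 0 ∧ E (linForm bas o 1 ^ m) = c • w) ∧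
      ∀ a x f, E (mapDer bas a x f) = ρ a x (E f) := by
  refine ⟨symEval bas ρ w o m, ⟨_, ?_, symEval_origin_pow bas w o hρ hm m⟩, fun a x f => ?_⟩
  -- The scalar is `m (m - 1) ⋯ 1 = m!`.
  · refine Finset.prod_ne_zero_iff.mpr fun i hi => sub_ne_zero.mpr ?_
    exact_mod_cast (Finset.mem_range.mp hi).ne'
  · induction x using Matrix.induction_on' with
    | h_zero => simp
    | h_add x y hx hy => simp [hx, hy]
    | h_std_basis p q c =>
      have hc : Matrix.single p q c = c • Matrix.single p q (1 : ℂ) := by simp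
      rw [hc, map_smul, map_smul, Derivation.smul_apply, LinearMap.smul_apply, map_smul]
      congr 1
      by_cases hq : q = o
      · subst hq
        -- The recursion from `m` to `m + 1` has left-hand side zero, which is precisely
        -- equivariance of `symEval` at `m` under `e_{p,o} ⊗ a`.
        have h1 := symEval_linForm_mul bas w q hρ m p a f
        rw [symEval_eq_zero bas w q hρ hw j hj hx, LinearMap.zero_apply, homAct_apply,
          eq_comm, sub_eq_zero] at h1
        exact h1.symm
      · exact symEval_mapDer_single bas w o hρ hw m a p q hq f

end SymEval

/-! ### The action of `gl_n ⊗ A` on the global Weyl module of highest weight `m ω_1` -/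

/-! ### Commutation formulas of `sl_2 ⊗ A` type -/

section SlTwo

variable {M : Type*} [AddCommGroup M] [Module ℂ M] {x y K p : Module.End ℂ M}

/-- In the application `x = x_{-i} ⊗ 1`, `y = x_{-i} ⊗ a`, `K = h_i ⊗ a` and `p = x_i ⊗ a`. -/
theorem cartan_apply_pow_succ (hK : ∀ v, K (x v) = x (K v) - (2 : ℂ) • y v)
    (hxy : ∀ v, x (y v) = y (x v)) (k : ℕ) (v : M) :
    K ((x ^ (k + 1)) v) = (x ^ (k + 1)) (K v) - (2 * (k + 1) : ℂ) • y ((x ^ k) v) := by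
  induction k with
  | zero => simp [hK]
  | succ k ih =>
    rw [pow_succ', Module.End.mul_apply, hK, ih, map_sub, map_smul, hxy,
      ← Module.End.mul_apply x (x ^ k), ← pow_succ', ← Module.End.mul_apply x (x ^ (k + 1)),
      ← pow_succ']
    push_cast
    module

theorem raising_apply_pow_add_two (hK : ∀ v, K (x v) = x (K v) - (2 : ℂ) • y v)
    (hxy : ∀ v, x (y v) = y (x v)) (hp : ∀ v, p (x v) = x (p v) + K v) (k : ℕ) (v : M) :
    p ((x ^ (k + 2)) v) = (x ^ (k + 2)) (p v) + (k + 2 : ℂ) • (x ^ (k + 1)) (K v) -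
      ((k + 2) * (k + 1) : ℂ) • y ((x ^ k) v) := by
  induction k with
  | zero =>
    simp only [pow_succ, pow_zero, one_mul, Module.End.mul_apply, hp, hK, map_add,
      Module.End.one_apply]
    push_cast
    module
  | succ k ih =>
    rw [pow_succ', Module.End.mul_apply, hp, ih, cartan_apply_pow_succ hK hxy]
    have h1 : ∀ l u, x ((x ^ l) u) = (x ^ (l + 1)) u := fun l u => by
      rw [pow_succ', Module.End.mul_apply]
    simp only [map_add, map_sub, map_smul, hxy, Module.End.mul_apply, h1, add_assoc, Nat.reduceAdd]
    push_cast
    module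

/-- If `x ^ (m + 1)` kills a highest weight vector `w`, then it kills `K w`. -/
theorem lowering_pow_cartan_eq_zero (hK : ∀ v, K (x v) = x (K v) - (2 : ℂ) • y v)
    (hxy : ∀ v, x (y v) = y (x v)) (hp : ∀ v, p (x v) = x (p v) + K v) {w : M} (hw : p w = 0)
    {m : ℕ} (hx : (x ^ (m + 1)) w = 0) : (x ^ (m + 1)) (K w) = 0 := by
  have h1 := cartan_apply_pow_succ hK hxy m w
  have h2 := raising_apply_pow_add_two hK hxy hp m w
  rw [hx, map_zero] at h1
  rw [pow_succ', Module.End.mul_apply, hx, map_zero, map_zero, hw, map_zero, zero_add] at h2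
  -- `h1` and `h2` are two independent relations between `x^{m+1} K w` and `y x^m w`; this
  -- combination eliminates the latter.
  have h3 : ((m : ℂ) + 2) • (x ^ (m + 1)) (K w) = 0 := by
    linear_combination (norm := module) (-2 : ℂ) • h2 + ((m : ℂ) + 2) • h1
  exact (smul_eq_zero_iff_right (by exact_mod_cast (by omega : m + 2 ≠ 0))).mp h3

end SlTwo

/-! ### Brackets and the universal property of the global Weyl module -/

section WeylModule

attribute [local instance] LieRing.ofAssociativeRing

variable {n : ℕ} {A : Type*} [CommRing A] [Algebra ℂ A]

theorem el_comm (z w : Sl n) (a b : A) :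
    el z a * el w b = el w b * el z a + el ⁅z, w⁆ (a * b) := by
  have h := (UniversalEnvelopingAlgebra.ι ℂ (L := A ⊗[ℂ] Sl n)).map_lie (a ⊗ₜ z) (b ⊗ₜ w)
  rw [LieAlgebra.ExtendScalars.bracket_tmul, LieRing.of_associative_ring_bracket] at h
  rw [el, el, el, h]
  abel

theorem el_add_left (z w : Sl n) (a : A) : el (z + w) a = el z a + el w a := by
  simp [el, TensorProduct.tmul_add]

theorem el_smul_left (c : ℂ) (z : Sl n) (a : A) : el (c • z) a = c • el z a := by
  rw [el, TensorProduct.tmul_smul, map_smul, el]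

theorem el_add_right (z : Sl n) (a b : A) : el z (a + b) = el z a + el z b := by
  simp [el, TensorProduct.add_tmul]

theorem el_smul_right (c : ℂ) (z : Sl n) (a : A) : el z (c • a) = c • el z a := by
  rw [el, ← TensorProduct.smul_tmul', map_smul, el]

theorem el_zero_left (a : A) : el (0 : Sl n) a = 0 := by simp [el]

theorem bracket_single_hElt {p q : Fin n} (hpq : p ≠ q) (i : Fin (n - 1)) :
    ⁅LieAlgebra.SpecialLinear.single p q hpq (1 : ℂ), hElt i⁆ =
      ((if q = lo i then 1 else 0) - (if q = hi i then 1 else 0) - (if lo i = p then 1 else 0) +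
        (if hi i = p then 1 else 0) : ℂ) • LieAlgebra.SpecialLinear.single p q hpq (1 : ℂ) := by
  apply Subtype.ext
  rw [LieAlgebra.SpecialLinear.sl_bracket]
  simp only [hElt, LieAlgebra.SpecialLinear.val_singleSubSingle,
    LieAlgebra.SpecialLinear.val_single, mul_sub, sub_mul, single_mul_single_ite,
    SetLike.val_smul]
  have h1 : ∀ r : Fin n, (if q = r then Matrix.single p r (1 : ℂ) else 0) =
      (if q = r then (1 : ℂ) else 0) • Matrix.single p q (1 : ℂ) := fun r => by
    split_ifs with h <;> simp [h]
  have h2 : ∀ r : Fin n, (if r = p then Matrix.single r q (1 : ℂ) else 0) =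
      (if r = p then (1 : ℂ) else 0) • Matrix.single p q (1 : ℂ) := fun r => by
    split_ifs with h <;> simp [h]
  rw [h1, h1, h2, h2]
  module

theorem bracket_nPos_hElt {x : Sl n} (hx : x ∈ nPos n) (i : Fin (n - 1)) : ⁅x, hElt i⁆ ∈ nPos n := by
  induction hx using Submodule.span_induction with
  | mem x hx =>
    obtain ⟨p, q, hpq, rfl⟩ := hx
    rw [bracket_single_hElt]
    exact Submodule.smul_mem _ _ (Submodule.subset_span ⟨p, q, hpq, rfl⟩)
  | zero => rw [zero_lie]; exact Submodule.zero_mem _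
  | add x y _ _ hx hy => rw [add_lie]; exact Submodule.add_mem _ hx hy
  | smul c x _ hx => rw [smul_lie]; exact Submodule.smul_mem _ _ hx

theorem bracket_cartan_hElt {x : Sl n} (hx : x ∈ cartan n) (i : Fin (n - 1)) : ⁅x, hElt i⁆ = 0 := by
  induction hx using Submodule.span_induction with
  | mem x hx =>
    obtain ⟨j, rfl⟩ := hx
    apply Subtype.ext
    rw [LieAlgebra.SpecialLinear.sl_bracket]
    have h : ∀ k : Fin (n - 1), (hElt k).val =
        Matrix.diagonal fun r => (if r = lo k then (1 : ℂ) else 0) - if r = hi k then 1 else 0 := by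
      intro k
      ext r s
      simp only [hElt, LieAlgebra.SpecialLinear.val_singleSubSingle, Matrix.sub_apply,
        Matrix.single_apply, Matrix.diagonal_apply]
      split_ifs <;> grind
    rw [h, h, Matrix.diagonal_mul_diagonal, Matrix.diagonal_mul_diagonal]
    simp [mul_comm]
  | zero => rw [zero_lie]
  | add x y _ _ hx hy => rw [add_lie, hx, hy, add_zero]
  | smul c x _ hx => rw [smul_lie, hx, smul_zero]

variable {c : Fin (n - 1) → ℕ}

theorem smul_highestWeightVector (u : UMap n A) :
    u • highestWeightVector n A c = Submodule.Quotient.mk u := by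
  rw [highestWeightVector, ← Submodule.Quotient.mk_smul, smul_eq_mul, mul_one]

theorem exists_smul_highestWeightVector (v : WeylModule n A c) :
    ∃ u : UMap n A, v = u • highestWeightVector n A c := by
  obtain ⟨u, rfl⟩ := Submodule.Quotient.mk_surjective _ v
  exact ⟨u, (smul_highestWeightVector u).symm⟩

theorem smul_highestWeightVector_eq_zero {u : UMap n A} (hu : u ∈ weylIdeal n A c) :
    u • highestWeightVector n A c = 0 := by
  rw [smul_highestWeightVector, Submodule.Quotient.mk_eq_zero]
  exact hu

theorem el_nPos_smul {x : Sl n} (hx : x ∈ nPos n) (a : A) :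
    el x a • highestWeightVector n A c = 0 :=
  smul_highestWeightVector_eq_zero (Submodule.subset_span (Or.inl (Or.inl ⟨x, hx, a, rfl⟩)))

theorem el_cartan_smul (h : cartan n) :
    el (h : Sl n) (1 : A) • highestWeightVector n A c =
      dominantWeight c h • highestWeightVector n A c := by
  have := smul_highestWeightVector_eq_zero (c := c)
    (Submodule.subset_span (Or.inl (Or.inr ⟨h, rfl⟩)) :
      el (h : Sl n) (1 : A) - algebraMap ℂ (UMap n A) (dominantWeight c h) ∈ _)
  rwa [sub_smul, algebraMap_smul, sub_eq_zero] at this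

theorem el_xNeg_pow_smul (i : Fin (n - 1)) :
    el (xNeg i) (1 : A) ^ (c i + 1) • highestWeightVector n A c = 0 :=
  smul_highestWeightVector_eq_zero (Submodule.subset_span (Or.inr ⟨i, rfl⟩))

/-- The universal property of the global Weyl module. -/
theorem exists_weylModule_lift {M : Type*} [AddCommGroup M] [Module ℂ M] [Module (UMap n A) M]
    [IsScalarTower ℂ (UMap n A) M] (v : M) (h1 : ∀ x ∈ nPos n, ∀ a : A, el x a • v = 0)
    (h2 : ∀ h : cartan n, el (h : Sl n) (1 : A) • v = dominantWeight c h • v)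
    (h3 : ∀ i : Fin (n - 1), el (xNeg i) (1 : A) ^ (c i + 1) • v = 0) :
    ∃ f : WeylModule n A c →ₗ[UMap n A] M, f (highestWeightVector n A c) = v := by
  have hle : weylIdeal n A c ≤ LinearMap.ker (LinearMap.toSpanSingleton (UMap n A) M v) := by
    refine Submodule.span_le.mpr ?_
    rintro u ((⟨x, hx, a, rfl⟩ | ⟨h, rfl⟩) | ⟨i, rfl⟩) <;>
      rw [SetLike.mem_coe, LinearMap.mem_ker, LinearMap.toSpanSingleton_apply]
    · exact h1 x hx a
    · rw [sub_smul, h2, algebraMap_smul, sub_self]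
    · exact h3 i
  refine ⟨(weylIdeal n A c).liftQ _ hle, ?_⟩
  rw [highestWeightVector, Submodule.liftQ_apply, LinearMap.toSpanSingleton_apply, one_smul]

end WeylModule

/-! ### Extension of the action from `sl_n ⊗ A` to `gl_n ⊗ A` -/

section GlAction

attribute [local instance] LieRing.ofAssociativeRing

variable {n : ℕ} {A : Type*} [CommRing A] [Algebra ℂ A]

/-- `x_i = e_{i,i+1}`. -/
def xPos (i : Fin (n - 1)) : Sl n :=
  LieAlgebra.SpecialLinear.single (lo i) (hi i) (lo_lt_hi i).ne (1 : ℂ)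

theorem xPos_mem_nPos (i : Fin (n - 1)) : xPos i ∈ nPos n :=
  Submodule.subset_span ⟨lo i, hi i, lo_lt_hi i, rfl⟩

theorem bracket_xPos_xNeg (i : Fin (n - 1)) : ⁅xPos i, xNeg i⁆ = hElt i := by
  apply Subtype.ext
  rw [LieAlgebra.SpecialLinear.sl_bracket]
  simp [xPos, xNeg, hElt]

theorem bracket_hElt_xNeg (i : Fin (n - 1)) : ⁅hElt i, xNeg i⁆ = (-2 : ℂ) • xNeg i := by
  have h := (lo_lt_hi i).ne
  rw [← lie_skew, xNeg, bracket_single_hElt]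
  simp only [h, if_true, if_false, sub_zero, ← neg_smul]
  norm_num

variable {c : Fin (n - 1) → ℕ}

theorem el_xNeg_smul (i : Fin (n - 1)) (hi : c i = 0) :
    el (xNeg i) (1 : A) • highestWeightVector n A c = 0 := by
  simpa [hi] using el_xNeg_pow_smul (A := A) (c := c) i

/-- `h_i ⊗ a` is the bracket of `x_i ⊗ a` and `x_{-i} ⊗ 1`, both of which kill the highest weight
vector. -/
theorem el_hElt_smul_eq_zero (i : Fin (n - 1)) (hi : c i = 0) (a : A) :
    el (hElt i) a • highestWeightVector n A c = 0 := by
  have h := congrArg (· • highestWeightVector n A c) (el_comm (xPos i) (xNeg i) a 1)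
  simp only [add_smul, mul_smul, el_xNeg_smul i hi, el_nPos_smul (xPos_mem_nPos i), smul_zero,
    bracket_xPos_xNeg, mul_one, zero_add] at h
  exact h.symm

/-- The bracket of `h_i ⊗ a` and `x_{-i} ⊗ 1` is `-2 x_{-i} ⊗ a`. -/
theorem el_xNeg_smul_eq_zero (i : Fin (n - 1)) (hi : c i = 0) (a : A) :
    el (xNeg i) a • highestWeightVector n A c = 0 := by
  have h := congrArg (· • highestWeightVector n A c) (el_comm (hElt i) (xNeg i) a 1)
  simp only [add_smul, mul_smul, el_xNeg_smul i hi, el_hElt_smul_eq_zero i hi, smul_zero,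
    bracket_hElt_xNeg, mul_one, zero_add, el_smul_left] at h
  rw [smul_assoc, eq_comm, smul_eq_zero_iff_right (by norm_num)] at h
  exact h

theorem el_xNeg_pow_smul_hElt (i : Fin (n - 1)) (a : A) :
    el (xNeg i) (1 : A) ^ (c i + 1) • el (hElt i) a • highestWeightVector n A c = 0 := by
  let Φ : UMap n A →ₐ[ℂ] Module.End ℂ (WeylModule n A c) := Algebra.lsmul ℂ ℂ _
  have hΦ : ∀ u v, Φ u v = u • v := fun _ _ => rfl
  have h := lowering_pow_cartan_eq_zero (x := Φ (el (xNeg i) 1)) (y := Φ (el (xNeg i) a))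
    (K := Φ (el (hElt i) a)) (p := Φ (el (xPos i) a)) (w := highestWeightVector n A c) (m := c i)
    (fun v => by
      simp only [hΦ]
      rw [← mul_smul, el_comm, bracket_hElt_xNeg, mul_one, add_smul, mul_smul, el_smul_left,
        smul_assoc, neg_smul, ← sub_eq_add_neg])
    (fun v => by
      simp only [hΦ]
      rw [← mul_smul, el_comm, lie_self, el_zero_left, add_zero, mul_smul])
    (fun v => by
      simp only [hΦ]
      rw [← mul_smul, el_comm, bracket_xPos_xNeg, mul_one, add_smul, mul_smul])
    (by rw [hΦ, el_nPos_smul (xPos_mem_nPos i)])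
    (by rw [← map_pow, hΦ, el_xNeg_pow_smul])
  rwa [← map_pow, hΦ, hΦ] at h

/-- If all but one of the coefficients of the highest weight vanish, then right multiplication by
`h_i ⊗ a` for the remaining index `i` descends to the global Weyl module. -/
theorem exists_hElt_right (i : Fin (n - 1)) (hc : ∀ j, j ≠ i → c j = 0) (a : A) :
    ∃ f : WeylModule n A c →ₗ[UMap n A] WeylModule n A c,
      f (highestWeightVector n A c) = el (hElt i) a • highestWeightVector n A c := by
  refine exists_weylModule_lift _ (fun x hx b => ?_) (fun h => ?_) (fun j => ?_)
  · rw [← mul_smul, el_comm, add_smul, mul_smul, el_nPos_smul hx,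
      el_nPos_smul (bracket_nPos_hElt hx i), smul_zero, add_zero]
  · rw [← mul_smul, el_comm, bracket_cartan_hElt h.2, el_zero_left, add_zero, mul_smul,
      el_cartan_smul, smul_comm]
  · by_cases hj : j = i
    · subst hj; exact el_xNeg_pow_smul_hElt j a
    · rw [hc j hj, zero_add, pow_one, ← mul_smul, el_comm, add_smul, mul_smul,
        el_xNeg_smul j (hc j hj), smul_zero, zero_add, xNeg, bracket_single_hElt, el_smul_left,
        smul_assoc, ← xNeg, el_xNeg_smul_eq_zero j (hc j hj), smul_zero]

/-- The traceless part of a matrix. -/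
def tracelessPart (hn : n ≠ 0) : Matrix (Fin n) (Fin n) ℂ →ₗ[ℂ] Sl n where
  toFun x := ⟨x - ((n : ℂ)⁻¹ * x.trace) • 1, by
    refine LinearMap.mem_ker.mpr ?_
    have : (n : ℂ) ≠ 0 := by exact_mod_cast hn
    rw [Matrix.traceLinearMap_apply, Matrix.trace_sub, Matrix.trace_smul, Matrix.trace_one,
      Fintype.card_fin, smul_eq_mul, mul_right_comm, inv_mul_cancel₀ this, one_mul, sub_self]⟩
  map_add' x y := Subtype.ext <| by
    simp only [Matrix.trace_add, mul_add, add_smul, AddMemClass.coe_add]; abel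
  map_smul' r x := Subtype.ext <| by
    simp only [Matrix.trace_smul, SetLike.val_smul, smul_sub, smul_smul, smul_eq_mul,
      RingHom.id_apply, mul_left_comm]

theorem tracelessPart_val (hn : n ≠ 0) (x : Matrix (Fin n) (Fin n) ℂ) :
    (tracelessPart hn x).val = x - ((n : ℂ)⁻¹ * x.trace) • 1 := rfl

theorem tracelessPart_of_mem (hn : n ≠ 0) (x : Sl n) : tracelessPart hn x.val = x := by
  have h : x.val.trace = 0 := LinearMap.mem_ker.mp x.2
  exact Subtype.ext (by rw [tracelessPart_val, h]; simp)

/-- Scalar matrices do not affect commutators, and commutators have trace zero. -/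
theorem tracelessPart_bracket (hn : n ≠ 0) (x y : Matrix (Fin n) (Fin n) ℂ) :
    ⁅tracelessPart hn x, tracelessPart hn y⁆ = tracelessPart hn (x * y - y * x) := by
  apply Subtype.ext
  rw [LieAlgebra.SpecialLinear.sl_bracket, tracelessPart_val, tracelessPart_val, tracelessPart_val,
    Matrix.trace_sub, Matrix.trace_mul_comm, sub_self]
  simp only [mul_sub, sub_mul, mul_smul_comm, smul_mul_assoc, mul_one, one_mul, mul_zero, zero_smul,
    smul_sub, smul_comm ((n : ℂ)⁻¹ * x.trace)]
  abel

/-- If all but one of the coefficients of the highest weight vanish, then the action of `sl_n ⊗ A`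
on the global Weyl module extends to `gl_n ⊗ A`, the central element `1 ⊗ a` acting on the highest
weight vector like `h_i ⊗ a`. -/
theorem exists_gl_action (hn : n ≠ 0) (i : Fin (n - 1)) (hc : ∀ j, j ≠ i → c j = 0) :
    ∃ ρ : A →ₗ[ℂ] Matrix (Fin n) (Fin n) ℂ →ₗ[ℂ] Module.End ℂ (WeylModule n A c),
      (∀ a b x y v, ρ a x (ρ b y v) - ρ b y (ρ a x v) = ρ (a * b) (x * y - y * x) v) ∧
      (∀ a (x : Sl n) v, ρ a x.val v = el x a • v) ∧
      (∀ a, ρ a 1 (highestWeightVector n A c) = el (hElt i) a • highestWeightVector n A c) := by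
  -- `θ a` commutes with the enveloping algebra, so it can serve as the action of the central
  -- element `1 ⊗ a`; the `θ a` commute with each other because the `h_i ⊗ a` do.
  choose θ hθ using exists_hElt_right (A := A) i hc
  have hθu : ∀ a (u : UMap n A), θ a (u • highestWeightVector n A c) =
      u • el (hElt i) a • highestWeightVector n A c := fun a u => by rw [map_smul, hθ]
  have hadd : ∀ a b v, θ (a + b) v = θ a v + θ b v := fun a b v => by
    obtain ⟨u, rfl⟩ := exists_smul_highestWeightVector v
    rw [hθu, hθu, hθu, el_add_right, add_smul, smul_add]
  have hsmul : ∀ (r : ℂ) a v, θ (r • a) v = r • θ a v := fun r a v => by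
    obtain ⟨u, rfl⟩ := exists_smul_highestWeightVector v
    rw [hθu, hθu, el_smul_right, smul_assoc, smul_comm]
  have hlin : ∀ (r : ℂ) a v, θ a (r • v) = r • θ a v := fun r a v => by
    rw [← algebraMap_smul (UMap n A) r v, map_smul, algebraMap_smul]
  have hcomm : ∀ a b v, θ a (θ b v) = θ b (θ a v) := fun a b v => by
    obtain ⟨u, rfl⟩ := exists_smul_highestWeightVector v
    rw [hθu, hθu, ← mul_smul, ← mul_smul, hθu, hθu, mul_smul, mul_smul, ← mul_smul (el _ _),
      ← mul_smul (el _ _), el_comm, lie_self, el_zero_left, add_zero]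
  let θ' : A → Module.End ℂ (WeylModule n A c) := fun a =>
    { toFun := θ a, map_add' := map_add (θ a), map_smul' := fun r v => hlin r a v }
  have hθ' : ∀ a v, θ' a v = θ a v := fun _ _ => rfl
  let Φ : UMap n A →ₐ[ℂ] Module.End ℂ (WeylModule n A c) := Algebra.lsmul ℂ ℂ _
  have hΦ : ∀ u v, Φ u v = u • v := fun _ _ => rfl
  let ρ : A →ₗ[ℂ] Matrix (Fin n) (Fin n) ℂ →ₗ[ℂ] Module.End ℂ (WeylModule n A c) :=
    LinearMap.mk₂ ℂ (fun a x => Φ (el (tracelessPart hn x) a) + ((n : ℂ)⁻¹ * x.trace) • θ' a)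
      (fun a b x => LinearMap.ext fun v => by
        simp only [LinearMap.add_apply, LinearMap.smul_apply, hθ', hΦ, hadd, el_add_right, add_smul,
          smul_add]
        abel)
      (fun r a x => LinearMap.ext fun v => by
        simp only [LinearMap.add_apply, LinearMap.smul_apply, hθ', hΦ, hsmul, el_smul_right,
          smul_add, smul_assoc, smul_comm r])
      (fun a x y => LinearMap.ext fun v => by
        simp only [LinearMap.add_apply, LinearMap.smul_apply, hθ', hΦ, map_add, el_add_left,
          Matrix.trace_add, mul_add, add_smul]
        abel)
      (fun r a x => LinearMap.ext fun v => by
        simp only [LinearMap.add_apply, LinearMap.smul_apply, hθ', hΦ, map_smul, el_smul_left,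
          Matrix.trace_smul, smul_add, smul_smul, smul_eq_mul, mul_left_comm])
  have hρ : ∀ a x v, ρ a x v =
      el (tracelessPart hn x) a • v + ((n : ℂ)⁻¹ * x.trace) • θ a v := fun _ _ _ => rfl
  refine ⟨ρ, fun a b x y v => ?_, fun a x v => ?_, fun a => ?_⟩
  · have h1 : Matrix.trace (x * y - y * x) = 0 := by
      rw [Matrix.trace_sub, Matrix.trace_mul_comm, sub_self]
    have h2 := congrArg (· • v) (el_comm (tracelessPart hn x) (tracelessPart hn y) a b)
    simp only [add_smul, mul_smul, tracelessPart_bracket] at h2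
    simp only [hρ, h1, smul_add, map_add, hlin, h2, mul_zero, zero_smul, add_zero, map_smul,
      hcomm a b]
    rw [smul_comm (el (tracelessPart hn x) a) ((n : ℂ)⁻¹ * _),
      smul_comm (el (tracelessPart hn y) b) ((n : ℂ)⁻¹ * _),
      smul_comm ((n : ℂ)⁻¹ * x.trace) ((n : ℂ)⁻¹ * y.trace)]
    abel
  · have h : x.val.trace = 0 := LinearMap.mem_ker.mp x.2
    rw [hρ, tracelessPart_of_mem, h, mul_zero, zero_smul, add_zero]
  · have h : (n : ℂ) ≠ 0 := by exact_mod_cast hn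
    have h1 : tracelessPart hn 1 = 0 := Subtype.ext <| by
      rw [tracelessPart_val]; simp [h]
    rw [hρ, h1, el_zero_left, zero_smul, zero_add, hθ, Matrix.trace_one, Fintype.card_fin,
      inv_mul_cancel₀ h, one_smul]

end GlAction

/-! ### The embedding of the global Weyl module into the polynomial representation -/

section PolyAction

attribute [local instance] LieRing.ofAssociativeRing

variable {n : ℕ} {A : Type*} [CommRing A] [Algebra ℂ A] {κ : Type*} (bas : Module.Basis κ ℂ A)

theorem uMap_induction {p : UMap n A → Prop} (halg : ∀ r : ℂ, p (algebraMap ℂ _ r))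
    (hel : ∀ z a, p (el z a)) (hadd : ∀ u v, p u → p v → p (u + v))
    (hmul : ∀ u v, p u → p v → p (u * v)) (u : UMap n A) : p u := by
  obtain ⟨t, rfl⟩ : ∃ t, UniversalEnvelopingAlgebra.mkAlgHom ℂ (A ⊗[ℂ] Sl n) t = u :=
    RingCon.mk'_surjective _ u
  induction t using TensorAlgebra.induction with
  | algebraMap r => rw [AlgHom.commutes]; exact halg r
  | ι x =>
    induction x using TensorProduct.induction_on with
    | zero => simpa using halg 0
    | tmul a z => exact hel z a
    | add x y hx hy => rw [map_add, map_add]; exact hadd _ _ hx hy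
  | mul s t hs ht => rw [map_mul]; exact hmul _ _ hs ht
  | add s t hs ht => rw [map_add]; exact hadd _ _ hs ht

/-- The action of `sl_n ⊗ A` on the symmetric algebra of `ℂⁿ ⊗ A` by derivations. -/
def polyLieHom : A ⊗[ℂ] Sl n →ₗ⁅ℂ⁆ Module.End ℂ (PolyRep n κ) :=
  let Φ : A ⊗[ℂ] Sl n →ₗ[ℂ] Module.End ℂ (PolyRep n κ) :=
    TensorProduct.lift (LinearMap.mk₂ ℂ (fun a z => (mapDer bas a z.val).toLinearMap)
      (fun a b z => by ext1; simp) (fun r a z => by ext1; simp) (fun a z z' => by ext1; simp)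
      (fun r a z => by ext1; simp))
  have hΦ : ∀ a z f, Φ (a ⊗ₜ z) f = mapDer bas a z.val f := fun _ _ _ => rfl
  { Φ with
    map_lie' := fun {x y} => by
      change Φ ⁅x, y⁆ = ⁅Φ x, Φ y⁆
      induction x using TensorProduct.induction_on with
      | zero => simp
      | add x x' hx hx' => rw [add_lie, map_add, hx, hx', map_add, add_lie]
      | tmul a z =>
        induction y using TensorProduct.induction_on with
        | zero =>
          have h := LieRing.lie_add (a ⊗ₜ[ℂ] z) 0 0
          rw [add_zero, right_eq_add] at h
          rw [h, map_zero, lie_zero]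
        | add y y' hy hy' => rw [LieRing.lie_add, map_add, hy, hy', map_add, lie_add]
        | tmul b z' =>
          refine LinearMap.ext fun f => ?_
          rw [LieAlgebra.ExtendScalars.bracket_tmul, LieRing.of_associative_ring_bracket,
            LinearMap.sub_apply, Module.End.mul_apply, Module.End.mul_apply]
          simp only [hΦ]
          rw [mapDer_comm, LieAlgebra.SpecialLinear.sl_bracket] }

/-- The action of `U(sl_n ⊗ A)` on the symmetric algebra of `ℂⁿ ⊗ A`. -/
def polyAction : UMap n A →ₐ[ℂ] Module.End ℂ (PolyRep n κ) :=
  UniversalEnvelopingAlgebra.lift ℂ (polyLieHom bas)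

theorem polyAction_el (z : Sl n) (a : A) (f : PolyRep n κ) :
    polyAction bas (el z a) f = mapDer bas a z.val f := by
  rw [polyAction, el, UniversalEnvelopingAlgebra.lift_ι_apply]
  rfl

theorem polyAction_isHomogeneous (u : UMap n A) {f : PolyRep n κ} {d : ℕ}
    (hf : f.IsHomogeneous d) : (polyAction bas u f).IsHomogeneous d := by
  induction u using uMap_induction generalizing f with
  | halg r =>
    rw [AlgHom.commutes, Module.algebraMap_end_apply]
    exact Submodule.smul_mem (MvPolynomial.homogeneousSubmodule _ ℂ d) r hf
  | hel z a => rw [polyAction_el]; exact mapDer_isHomogeneous bas _ _ hf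
  | hadd u v hu hv => rw [map_add, LinearMap.add_apply]; exact (hu hf).add (hv hf)
  | hmul u v hu hv => rw [map_mul, Module.End.mul_apply]; exact hu (hv hf)

/-- Each application trades one factor `e_j ⊗ 1` for `e_i ⊗ 1`, and only `m < k` of them are
available. -/
theorem mapDer_pow_eq_zero (i j : Fin n) (hij : i ≠ j) {k m : ℕ} (hm : m < k) (l : ℕ) :
    ((mapDer bas 1 (Matrix.single i j 1)).toLinearMap ^ k)
      (linForm bas i 1 ^ l * linForm bas j 1 ^ m) = 0 := by
  induction k generalizing m l with
  | zero => omega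
  | succ k ih =>
    have hD : mapDer bas 1 (Matrix.single i j 1) (linForm bas i 1 ^ l * linForm bas j 1 ^ m) =
        m • (linForm bas i 1 ^ (l + 1) * linForm bas j 1 ^ (m - 1)) := by
      rw [Derivation.leibniz, Derivation.leibniz_pow, Derivation.leibniz_pow, mapDer_single_linForm,
        mapDer_single_linForm, if_pos rfl, if_neg hij.symm, smul_zero, smul_zero, smul_zero,
        add_zero, mul_one, smul_comm, smul_eq_mul, smul_eq_mul]
      congr 1
      ring
    rw [pow_succ, Module.End.mul_apply, Derivation.coeFn_coe, hD, map_nsmul]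
    rcases m with _ | m
    · simp
    · rw [ih (by omega), smul_zero]

theorem dominantWeight_mulOmegaOne (hn : 0 < n - 1) (m : ℕ) (h : cartan n) :
    dominantWeight (mulOmegaOne n m) h = m * (h : Sl n).val (lo ⟨0, hn⟩) (lo ⟨0, hn⟩) := by
  have h1 : Finset.Iic (lo (⟨0, hn⟩ : Fin (n - 1))) = {lo ⟨0, hn⟩} := by
    ext k; simp [lo, Fin.le_def, Fin.ext_iff]
  rw [dominantWeight, LinearMap.sum_apply, Finset.sum_eq_single ⟨0, hn⟩]
  · simp [mulOmegaOne, fundamentalWeight, h1]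
  · intro i _ hi
    have : (i : ℕ) ≠ 0 := fun h => hi (Fin.ext h)
    simp [mulOmegaOne, this]
  · simp

/-- The homomorphism from the global Weyl module of highest weight `m ω_1` to the symmetric algebra
of `ℂⁿ ⊗ A`. -/
theorem exists_weylModule_toPoly (hn : 0 < n - 1) (m : ℕ) :
    ∃ Ψ : WeylModule n A (mulOmegaOne n m) →ₗ[ℂ] PolyRep n κ, ∀ u : UMap n A,
      Ψ (u • highestWeightVector n A (mulOmegaOne n m)) =
        polyAction bas u (linForm bas (lo ⟨0, hn⟩) 1 ^ m) := by
  set o : Fin n := lo ⟨0, hn⟩ with ho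
  let : Module (UMap n A) (PolyRep n κ) :=
    Module.compHom (PolyRep n κ) (polyAction bas : UMap n A →ₐ[ℂ] _).toRingHom
  have hsm : ∀ (u : UMap n A) (f : PolyRep n κ), u • f = polyAction bas u f := fun _ _ => rfl
  have : IsScalarTower ℂ (UMap n A) (PolyRep n κ) :=
    ⟨fun r u f => by rw [hsm, hsm, map_smul, LinearMap.smul_apply]⟩
  have hD : ∀ (a : A) (x : Matrix (Fin n) (Fin n) ℂ) (r : ℂ),
      mapDer bas a x (linForm bas o 1) = r • linForm bas o 1 →
      mapDer bas a x (linForm bas o 1 ^ m) = ((m : ℂ) * r) • linForm bas o 1 ^ m := by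
    intro a x r h
    rw [Derivation.leibniz_pow, h, smul_eq_mul, mul_smul_comm, ← Nat.cast_smul_eq_nsmul ℂ,
      ← mul_smul]
    rcases m with _ | m
    · simp
    · rw [Nat.add_sub_cancel, ← pow_succ]
  have h1 : ∀ x ∈ nPos n, ∀ a : A, el x a • (linForm bas o 1 ^ m) = 0 := fun x hx a => by
    rw [hsm, polyAction_el, hD a x.val 0, mul_zero, zero_smul]
    rw [zero_smul, mapDer_linForm]
    refine Finset.sum_eq_zero fun i _ => ?_
    suffices h : x.val i o = 0 by rw [h, zero_smul]
    induction hx using Submodule.span_induction with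
    | mem x hx =>
      obtain ⟨p, q, hpq, rfl⟩ := hx
      have : q ≠ o := by
        rintro rfl
        simp [ho, lo, Fin.lt_def] at hpq
      simp [this]
    | zero => rfl
    | add x y _ _ hx hy =>
      change x.val i o + y.val i o = 0
      rw [hx, hy, add_zero]
    | smul r x _ hx =>
      change r * x.val i o = 0
      rw [hx, mul_zero]
  have h2 : ∀ h : cartan n, el (h : Sl n) (1 : A) • (linForm bas o 1 ^ m) =
      dominantWeight (mulOmegaOne n m) h • (linForm bas o 1 ^ m) := fun h => by
    rw [hsm, polyAction_el, dominantWeight_mulOmegaOne hn]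
    refine hD 1 _ _ ?_
    rw [mapDer_linForm, mul_one, Finset.sum_eq_single o (fun i _ hi => ?_) (by simp)]
    suffices h' : (h : Sl n).val i o = 0 by rw [h', zero_smul]
    obtain ⟨x, hx⟩ := h
    change x.val i o = 0
    induction hx using Submodule.span_induction with
    | mem x hx =>
      obtain ⟨j, rfl⟩ := hx
      simp only [hElt, LieAlgebra.SpecialLinear.val_singleSubSingle, Matrix.sub_apply,
        Matrix.single_apply]
      grind
    | zero => rfl
    | add x y _ _ hx hy =>
      change x.val i o + y.val i o = 0
      rw [hx, hy, add_zero]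
    | smul r x _ hx =>
      change r * x.val i o = 0
      rw [hx, mul_zero]
  have h3 : ∀ i : Fin (n - 1), el (xNeg i) (1 : A) ^ (mulOmegaOne n m i + 1) •
      (linForm bas o 1 ^ m) = 0 := fun i => by
    rw [hsm, map_pow (polyAction bas)]
    have hx : polyAction bas (el (xNeg i) (1 : A)) =
        (mapDer bas 1 (Matrix.single (hi i) (lo i) 1)).toLinearMap :=
      LinearMap.ext fun f => polyAction_el bas _ _ f
    rw [hx]
    by_cases h0 : (i : ℕ) = 0
    · have hi : o = lo i := Fin.ext h0.symm
      rw [hi]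
      simpa using mapDer_pow_eq_zero bas (GlobalWeyl.hi i) (lo i) (lo_lt_hi i).ne'
        (show m < mulOmegaOne n m i + 1 by simp [mulOmegaOne, h0]) 0
    · have hi : lo i ≠ o := fun h => h0 (Fin.ext_iff.mp h)
      rw [mulOmegaOne, if_neg h0, zero_add, pow_one, Derivation.coeFn_coe, hD 1 _ 0, mul_zero,
        zero_smul]
      rw [mapDer_single_linForm, if_neg hi, zero_smul]
  obtain ⟨f, hf⟩ := exists_weylModule_lift (linForm bas o 1 ^ m) h1 h2 h3
  refine ⟨f.restrictScalars ℂ, fun u => ?_⟩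
  rw [LinearMap.restrictScalars_apply, map_smul, hf, hsm]

end PolyAction

/-! ### Injectivity of the map to the symmetric algebra -/

section Injectivity

variable {n : ℕ} {A : Type*} [CommRing A] [Algebra ℂ A] {κ : Type*} (bas : Module.Basis κ ℂ A)
  {W : Type*} [AddCommGroup W] [Module ℂ W]
  {ρ : A →ₗ[ℂ] Matrix (Fin n) (Fin n) ℂ →ₗ[ℂ] Module.End ℂ W} {w : W}

/-- If the `e_{i,i+1} ⊗ a` with `i ≥ 1` and the `e_{i+1,i} ⊗ 1` with `i ≥ 1` kill `w`, and the
identity acts on `w` like `h_0`, then `w` is killed by all `e_{i,j} ⊗ a` with `j ≠ 0`. -/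
theorem gl_action_single_eq_zero (hn : 0 < n - 1)
    (hρ : ∀ (a b : A) (x y : Matrix (Fin n) (Fin n) ℂ) (v : W),
      ρ a x (ρ b y v) - ρ b y (ρ a x v) = ρ (a * b) (x * y - y * x) v)
    (hpos : ∀ (a : A) (i j : Fin n), i < j → ρ a (Matrix.single i j 1) w = 0)
    (hneg : ∀ i : Fin (n - 1), (i : ℕ) ≠ 0 → ρ 1 (Matrix.single (hi i) (lo i) 1) w = 0)
    (hone : ∀ a, ρ a 1 w = ρ a (Matrix.single (lo ⟨0, hn⟩) (lo ⟨0, hn⟩) 1) w -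
      ρ a (Matrix.single (hi ⟨0, hn⟩) (hi ⟨0, hn⟩) 1) w)
    (a : A) (i j : Fin n) (hj : j ≠ lo ⟨0, hn⟩) : ρ a (Matrix.single i j 1) w = 0 := by
  -- The difference of the two sides is the bracket of `e_{i,i+1} ⊗ a` with `e_{i+1,i} ⊗ 1`, both of
  -- which kill `w`.
  have hdiag : ∀ (a : A) (i : Fin (n - 1)), (i : ℕ) ≠ 0 →
      ρ a (Matrix.single (lo i) (lo i) 1) w = ρ a (Matrix.single (hi i) (hi i) 1) w := by
    intro a i hi0
    have h := hρ a 1 (Matrix.single (lo i) (hi i) 1) (Matrix.single (hi i) (lo i) 1) w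
    rw [hneg i hi0, hpos a _ _ (lo_lt_hi i), map_zero, map_zero, sub_zero, mul_one,
      single_mul_single_ite, single_mul_single_ite, if_pos rfl, if_pos rfl, map_sub,
      LinearMap.sub_apply, eq_comm, sub_eq_zero] at h
    exact h
  -- Bracketing `e_{i+1,i} ⊗ 1` with `-h_i ⊗ a` yields `2 e_{i+1,i} ⊗ a`.
  have hsucc : ∀ (a : A) (i : Fin (n - 1)), (i : ℕ) ≠ 0 →
      ρ a (Matrix.single (hi i) (lo i) 1) w = 0 := by
    intro a i hi0
    have h := hρ a 1 (Matrix.single (hi i) (hi i) 1 - Matrix.single (lo i) (lo i) 1)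
      (Matrix.single (hi i) (lo i) 1) w
    have hne := (lo_lt_hi i).ne
    rw [hneg i hi0, map_zero, map_sub, LinearMap.sub_apply, hdiag a i hi0, sub_self, map_zero,
      sub_zero, mul_one, sub_mul, mul_sub] at h
    simp only [single_mul_single_ite, if_true, hne, if_false, sub_zero, zero_sub,
      sub_neg_eq_add, map_add, LinearMap.add_apply] at h
    rw [← two_smul ℂ, eq_comm, smul_eq_zero_iff_right two_ne_zero] at h
    exact h
  -- Below the subdiagonal, `e_{i,j} = [e_{i,i-1}, e_{i-1,j}]`.
  have hlow : ∀ (d : ℕ) (a : A) (i j : Fin n), (j : ℕ) ≠ 0 → (i : ℕ) = j + d + 1 →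
      ρ a (Matrix.single i j 1) w = 0 := by
    intro d
    induction d with
    | zero =>
      intro a i j hj hij
      have := hsucc a ⟨j, by omega⟩ hj
      convert this using 3
      exact congrArg₂ (fun i j => Matrix.single i j (1 : ℂ)) (Fin.ext hij) rfl
    | succ d ih =>
      intro a i j hj hij
      let k : Fin (n - 1) := ⟨j + d + 1, by omega⟩
      have hi' : hi k = i := Fin.ext (by simp only [hi, k]; omega)
      have hij' : j ≠ i := fun h => by rw [h] at hij; omega
      have h := hρ a 1 (Matrix.single (hi k) (lo k) 1) (Matrix.single (lo k) j 1) w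
      rw [hsucc a k (by simp only [k]; omega), ih 1 (lo k) j hj rfl, map_zero, map_zero, sub_zero,
        mul_one, single_mul_single_ite, single_mul_single_ite, if_pos rfl, hi', if_neg hij',
        sub_zero] at h
      exact h.symm
  have hdiag' : ∀ (a : A) (j : Fin n), j ≠ lo ⟨0, hn⟩ →
      ρ a (Matrix.single j j 1) w = ρ a (Matrix.single (hi ⟨0, hn⟩) (hi ⟨0, hn⟩) 1) w := by
    intro a j hj
    have hj0 : (j : ℕ) ≠ 0 := fun h => hj (Fin.ext h)
    obtain ⟨d, hd⟩ : ∃ d, (j : ℕ) = d + 1 := ⟨j - 1, by omega⟩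
    induction d generalizing j with
    | zero =>
      have : j = hi ⟨0, hn⟩ := Fin.ext hd
      rw [this]
    | succ d ih =>
      let k : Fin (n - 1) := ⟨d + 1, by omega⟩
      have hk : hi k = j := Fin.ext hd.symm
      have hk0 : ((lo k : Fin n) : ℕ) ≠ 0 := Nat.succ_ne_zero d
      rw [← hk, ← hdiag a k hk0]
      exact ih (lo k) (fun h => hk0 (by rw [h]; rfl)) hk0 rfl
  rcases lt_trichotomy i j with hij | rfl | hij
  · exact hpos a i j hij
  · rw [hdiag' a i hj]
    -- In 0-based indices the identity acts on `w` as `e_{0,0} + (n - 1) e_{1,1}`, and by `hone` as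
    -- `e_{0,0} - e_{1,1}`; hence `n e_{1,1} ⊗ a` kills `w`.
    have hsum : (1 : Matrix (Fin n) (Fin n) ℂ) = ∑ i, Matrix.single i i 1 := by
      rw [Matrix.sum_single_one]
    have h := hone a
    rw [hsum, map_sum, LinearMap.sum_apply, ← Finset.add_sum_erase _ _
      (Finset.mem_univ (lo ⟨0, hn⟩)), sub_eq_add_neg, add_right_inj,
      Finset.sum_congr rfl (fun j hj => hdiag' a j (Finset.ne_of_mem_erase hj)), Finset.sum_const,
      ← add_eq_zero_iff_eq_neg, ← succ_nsmul, ← Nat.cast_smul_eq_nsmul ℂ,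
      smul_eq_zero_iff_right (Nat.cast_ne_zero.mpr (Nat.succ_ne_zero _))] at h
    exact h
  · exact hlow (i - j - 1) a i j (fun h => hj (Fin.ext h)) (by have := Fin.lt_def.mp hij; omega)

/-- The homomorphism from the global Weyl module of highest weight `m ω_1` to the symmetric algebra
of `ℂⁿ ⊗ A` is injective. -/
theorem weylModule_toPoly_injective (hn : 0 < n - 1) (m : ℕ)
    (Ψ : WeylModule n A (mulOmegaOne n m) →ₗ[ℂ] PolyRep n κ)
    (hΨ : ∀ u : UMap n A, Ψ (u • highestWeightVector n A (mulOmegaOne n m)) =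
      polyAction bas u (linForm bas (lo ⟨0, hn⟩) 1 ^ m)) :
    Function.Injective Ψ := by
  set w := highestWeightVector n A (mulOmegaOne n m) with hw
  have hc : ∀ j : Fin (n - 1), j ≠ ⟨0, hn⟩ → mulOmegaOne n m j = 0 := fun j hj =>
    if_neg fun h => hj (Fin.ext h)
  obtain ⟨ρ, hρ, hel, hone⟩ := exists_gl_action (A := A) (by omega) ⟨0, hn⟩ hc
  have hsing : ∀ (a : A) (i j : Fin n) (hij : i ≠ j) v,
      ρ a (Matrix.single i j 1) v = el (LieAlgebra.SpecialLinear.single i j hij (1 : ℂ)) a • v :=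
    fun a i j hij v => hel a (LieAlgebra.SpecialLinear.single i j hij 1) v
  have hone' : ∀ a, ρ a 1 w = ρ a (Matrix.single (lo ⟨0, hn⟩) (lo ⟨0, hn⟩) 1) w -
      ρ a (Matrix.single (hi ⟨0, hn⟩) (hi ⟨0, hn⟩) 1) w := fun a => by
    rw [hone, ← hel, hElt, LieAlgebra.SpecialLinear.val_singleSubSingle, map_sub,
      LinearMap.sub_apply]
  have hzero : ∀ (a : A) (i j : Fin n), j ≠ lo ⟨0, hn⟩ → ρ a (Matrix.single i j 1) w = 0 :=
    gl_action_single_eq_zero hn hρ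
      (fun a i j hij => by
        rw [hsing a i j hij.ne, el_nPos_smul (Submodule.subset_span ⟨i, j, hij, rfl⟩)])
      (fun i hi0 => by
        rw [hsing 1 _ _ (lo_lt_hi i).ne']
        exact el_xNeg_smul i (if_neg hi0))
      hone'
  have hm : ρ 1 (Matrix.single (lo ⟨0, hn⟩) (lo ⟨0, hn⟩) 1) w = (m : ℂ) • w := by
    have h := hone' 1
    rw [hzero 1 _ _ (lo_lt_hi _).ne', sub_zero, hone] at h
    rw [← h, el_cartan_smul ⟨_, hElt_mem_cartan _⟩, dominantWeight_hElt]
    simp [mulOmegaOne, hw]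
  have hx : (ρ 1 (Matrix.single (hi ⟨0, hn⟩) (lo ⟨0, hn⟩) 1) ^ (m + 1)) w = 0 := by
    have h : ρ 1 (Matrix.single (hi ⟨0, hn⟩) (lo ⟨0, hn⟩) 1) =
        (Algebra.lsmul ℂ ℂ (WeylModule n A (mulOmegaOne n m))) (el (xNeg ⟨0, hn⟩) (1 : A)) :=
      LinearMap.ext fun v => hsing 1 _ _ (lo_lt_hi _).ne' v
    rw [h, ← map_pow, Algebra.lsmul_coe]
    have h2 := el_xNeg_pow_smul (A := A) (c := mulOmegaOne n m) ⟨0, hn⟩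
    simpa [mulOmegaOne] using h2
  obtain ⟨E, ⟨r, hr, hE⟩, hEq⟩ := exists_equivariant_of_highestWeight bas w (lo ⟨0, hn⟩) hρ hzero hm
    (hi ⟨0, hn⟩) (lo_lt_hi _).ne' hx
  have hEu : ∀ (u : UMap n A) f, E (polyAction bas u f) = u • E f := by
    intro u
    induction u using uMap_induction with
    | halg s =>
      intro f
      rw [AlgHom.commutes, Module.algebraMap_end_apply, map_smul, algebraMap_smul]
    | hel z a => intro f; rw [polyAction_el, hEq, hel]
    | hadd u v hu hv => intro f; rw [map_add, LinearMap.add_apply, map_add, hu, hv, add_smul]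
    | hmul u v hu hv => intro f; rw [map_mul, Module.End.mul_apply, hu, hv, mul_smul]
  refine (injective_iff_map_eq_zero Ψ).mpr fun v hv => ?_
  obtain ⟨u, rfl⟩ := exists_smul_highestWeightVector v
  rw [hΨ] at hv
  -- `E (Ψ (u w)) = u E ((e_0 ⊗ 1)^m) = r u w` with `r ≠ 0`, so `Ψ (u w) = 0` forces `u w = 0`.
  have h := hEu u (linForm bas (lo ⟨0, hn⟩) 1 ^ m)
  rw [hv, map_zero, hE, smul_comm, eq_comm, smul_eq_zero_iff_right hr] at h
  exact h

end Injectivity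

/-! ### Divided monomials and multinomial coefficients -/

section DivPow

variable {S R : Type*} [CommRing R] [Algebra ℂ R]

/-- The divided monomial `∏ a, y(a) ^ χ(a) / χ(a)!`. -/
def divPow (y : S → R) (χ : S →₀ ℕ) : R :=
  χ.prod fun a k => ((Nat.factorial k : ℂ)⁻¹) • y a ^ k

theorem divPow_zero (y : S → R) : divPow y 0 = 1 := Finsupp.prod_zero_index

/-- Separates the `b`-factor of `χ` and of `χ - b` from their common cofactor `r`, so that
identities between them reduce to one variable. -/
theorem exists_divPow_eq [DecidableEq S] (y : S → R) {χ : S →₀ ℕ} {b : S} (hb : b ∈ χ.support) :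
    ∃ r k, χ b = k + 1 ∧ r = ∏ a ∈ χ.support.erase b, ((Nat.factorial (χ a) : ℂ)⁻¹) • y a ^ χ a ∧
      divPow y χ = (((Nat.factorial (k + 1) : ℂ)⁻¹) • y b ^ (k + 1)) * r ∧
      divPow y (χ - Finsupp.single b 1) = (((Nat.factorial k : ℂ)⁻¹) • y b ^ k) * r := by
  obtain ⟨k, hk⟩ := Nat.exists_eq_succ_of_ne_zero (Finsupp.mem_support_iff.mp hb)
  refine ⟨_, k, hk, rfl, ?_, ?_⟩
  · rw [divPow, Finsupp.prod, ← Finset.mul_prod_erase _ _ hb, hk]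
  · rw [divPow, Finsupp.prod_of_support_subset _ Finsupp.support_tsub _ (by simp),
      ← Finset.mul_prod_erase _ _ hb]
    congr 1
    · simp [hk]
    · refine Finset.prod_congr rfl fun a ha => ?_
      simp [(Finset.ne_of_mem_erase ha).symm]

theorem mul_divPow_sub_single (y : S → R) {χ : S →₀ ℕ} {b : S} (hb : b ∈ χ.support) :
    y b * divPow y (χ - Finsupp.single b 1) = (χ b : ℂ) • divPow y χ := by
  classical
  obtain ⟨r, k, hk, _, h1, h2⟩ := exists_divPow_eq y hb
  have h0 : (Nat.factorial k : ℂ) ≠ 0 := by exact_mod_cast Nat.factorial_ne_zero k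
  have h3 : (k + 1 : ℂ) ≠ 0 := by exact_mod_cast Nat.succ_ne_zero k
  rw [h1, h2, hk, ← mul_assoc, mul_smul_comm, ← pow_succ', ← smul_mul_assoc, smul_smul,
    Nat.factorial_succ]
  push_cast
  rw [mul_inv, mul_inv_cancel_left₀ h3]

/-- Euler's identity for divided monomials; the factor `|χ|` cancels the `1 / |χ|` in the recursion
for `q_i`. -/
theorem sum_mul_divPow_sub_single (y : S → R) (χ : S →₀ ℕ) :
    ∑ b ∈ χ.support, y b * divPow y (χ - Finsupp.single b 1) = (χ.degree : ℂ) • divPow y χ := by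
  rw [Finset.sum_congr rfl fun b hb => mul_divPow_sub_single y hb, ← Finset.sum_smul,
    Finsupp.degree_apply, Nat.cast_sum]

theorem derivation_prod (δ : Derivation ℂ R R) [DecidableEq S] (s : Finset S) (f : S → R) :
    δ (∏ a ∈ s, f a) = ∑ b ∈ s, δ (f b) * ∏ a ∈ s.erase b, f a := by
  induction s using Finset.induction_on with
  | empty => simp
  | insert c s hc ih =>
    rw [Finset.prod_insert hc, Derivation.leibniz, Finset.sum_insert hc, Finset.erase_insert hc, ih,
      smul_eq_mul, smul_eq_mul, add_comm, mul_comm, Finset.mul_sum]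
    congr 1
    refine Finset.sum_congr rfl fun b hb => ?_
    have hcb : c ≠ b := fun h => hc (h ▸ hb)
    rw [Finset.erase_insert_of_ne hcb, Finset.prod_insert (fun h => hc (Finset.mem_of_mem_erase h))]
    ring

theorem derivation_divPow (δ : Derivation ℂ R R) (y : S → R) (χ : S →₀ ℕ) :
    δ (divPow y χ) = ∑ b ∈ χ.support, δ (y b) * divPow y (χ - Finsupp.single b 1) := by
  classical
  rw [divPow, Finsupp.prod, derivation_prod]
  refine Finset.sum_congr rfl fun b hb => ?_
  obtain ⟨r, k, hk, hr, _, h2⟩ := exists_divPow_eq y hb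
  have h3 : (k + 1 : ℂ) ≠ 0 := by exact_mod_cast Nat.succ_ne_zero k
  rw [← hr, h2, hk, Derivation.map_smul, Derivation.leibniz_pow, Nat.add_sub_cancel,
    ← Nat.cast_smul_eq_nsmul ℂ, smul_smul, Nat.factorial_succ, smul_eq_mul]
  push_cast
  rw [mul_comm (k + 1 : ℂ), mul_inv, inv_mul_cancel_right₀ h3, ← mul_assoc, mul_comm (y b ^ k),
    mul_smul_comm]

theorem multinomial_eq_factorial_mul_divPow (ψ : S →₀ ℕ) :
    (ψ.multinomial : ℂ) = (Nat.factorial ψ.degree : ℂ) * divPow (fun _ => (1 : ℂ)) ψ := by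
  have h := Nat.multinomial_spec ψ.support ψ
  rw [← Finsupp.multinomial_eq, ← Finsupp.degree_apply] at h
  have h0 : (∏ a ∈ ψ.support, (Nat.factorial (ψ a) : ℂ)) ≠ 0 :=
    Finset.prod_ne_zero_iff.mpr fun a _ => by exact_mod_cast Nat.factorial_ne_zero _
  have h1 : divPow (fun _ => (1 : ℂ)) ψ = (∏ a ∈ ψ.support, (Nat.factorial (ψ a) : ℂ))⁻¹ := by
    simp [divPow, Finsupp.prod]
  rw [h1, ← h]
  push_cast
  field_simp

/-- Pascal's rule for multinomial coefficients, which is Euler's identity with every `y b` equal to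
`1`. -/
theorem sum_multinomial_sub_single {ψ : S →₀ ℕ} (hψ : ψ ≠ 0) :
    ∑ b ∈ ψ.support, ((ψ - Finsupp.single b 1).multinomial : ℂ) = ψ.multinomial := by
  obtain ⟨k, hk⟩ := Nat.exists_eq_succ_of_ne_zero
    (fun h => hψ ((Finsupp.degree_eq_zero_iff ψ).mp h))
  have h := sum_mul_divPow_sub_single (fun _ => (1 : ℂ)) ψ
  simp only [one_mul, hk, smul_eq_mul] at h
  have hd : ∀ b ∈ ψ.support, (ψ - Finsupp.single b 1).degree = k := fun b hb => by
    have h1 : (ψ - Finsupp.single b 1).degree + (Finsupp.single b 1).degree = ψ.degree := by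
      rw [← map_add, tsub_add_cancel_of_le (single_one_le hb)]
    rw [Finsupp.degree_single] at h1
    omega
  simp only [multinomial_eq_factorial_mul_divPow]
  rw [Finset.sum_congr rfl fun b hb => by rw [hd b hb], ← Finset.mul_sum, h, hk,
    Nat.succ_eq_add_one, Nat.factorial_succ]
  push_cast
  ring

-- Reindex by `ψ + χ_b`: a nonzero `ψ` is reached once from each `b` in its support, and Pascal's
-- rule adds up the coefficients.
open Classical in
theorem sum_multinomial_smul_add_single {M : Type*} [AddCommGroup M] [Module ℂ M] (χ : S →₀ ℕ)
    (G : (S →₀ ℕ) → M) :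
    ∑ ψ ∈ Finset.Icc 0 χ, ∑ b ∈ (χ - ψ).support,
        (ψ.multinomial : ℂ) • G (ψ + Finsupp.single b 1) =
      ∑ ψ ∈ (Finset.Icc 0 χ).erase 0, (ψ.multinomial : ℂ) • G ψ := by
  have h : ∀ ψ ∈ (Finset.Icc 0 χ).erase 0, (ψ.multinomial : ℂ) • G ψ =
      ∑ b ∈ ψ.support, ((ψ - Finsupp.single b 1).multinomial : ℂ) • G ψ := fun ψ hψ => by
    rw [← sum_multinomial_sub_single (Finset.ne_of_mem_erase hψ), Finset.sum_smul]
  rw [Finset.sum_congr rfl h, Finset.sum_sigma', Finset.sum_sigma']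
  refine Finset.sum_bij' (fun p _ => ⟨p.1 + Finsupp.single p.2 1, p.2⟩)
    (fun p _ => ⟨p.1 - Finsupp.single p.2 1, p.2⟩) ?_ ?_ ?_ ?_ ?_
  · rintro ⟨ψ, b⟩ hp
    simp only [Finset.mem_sigma, Finset.mem_Icc, zero_le, true_and, Finset.mem_erase] at hp ⊢
    refine ⟨⟨by simp, ?_⟩, by simp⟩
    have := single_one_le hp.2
    calc ψ + Finsupp.single b 1 ≤ ψ + (χ - ψ) := by gcongr
      _ = χ := add_tsub_cancel_of_le hp.1
  · rintro ⟨ψ, b⟩ hp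
    simp only [Finset.mem_sigma, Finset.mem_Icc, zero_le, true_and, Finset.mem_erase] at hp ⊢
    refine ⟨tsub_le_self.trans hp.1.2, ?_⟩
    have h1 := hp.1.2 b
    have h2 := Finsupp.mem_support_iff.mp hp.2
    simp only [Finsupp.mem_support_iff, Finsupp.coe_tsub, Pi.sub_apply, Finsupp.single_eq_same]
    omega
  · rintro ⟨ψ, b⟩ hp
    simp
  · rintro ⟨ψ, b⟩ hp
    simp only [Finset.mem_sigma] at hp
    simp [tsub_add_cancel_of_le (single_one_le hp.2)]
  · rintro ⟨ψ, b⟩ hp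
    simp

theorem prodOf_zero {A : Type*} [CommRing A] : prodOf (0 : A →₀ ℕ) = 1 := Finsupp.prod_zero_index

theorem prodOf_add_single {A : Type*} [CommRing A] (ψ : A →₀ ℕ) (b : A) :
    prodOf (ψ + Finsupp.single b 1) = prodOf ψ * b := by
  classical
  rw [prodOf, Finsupp.prod_add_index' (fun _ => pow_zero _) (fun _ _ _ => pow_add _ _ _),
    Finsupp.prod_single_index (pow_zero _), pow_one, prodOf]

open Classical in
/-- If `δ_a` sends `y_b` to `u_{ab}` and lowers `c_j` to `-c_{j+1} u_a`, then summing over all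
`ψ ≤ χ` telescopes. -/
theorem sum_multinomial_smul_derivation {A : Type*} [CommRing A] (δ : A → Derivation ℂ R R)
    (y u : A → R) (c : ℕ → R) (hy : ∀ a b, δ a (y b) = u (a * b))
    (hc : ∀ a j, δ a (c j) = -(u a * c (j + 1))) (χ : A →₀ ℕ) :
    ∑ ψ ∈ Finset.Icc 0 χ, (ψ.multinomial : ℂ) •
        δ (prodOf ψ) (divPow y (χ - ψ) * c (χ - ψ).degree) =
      -(u 1 * divPow y χ * c (χ.degree + 1)) := by
  -- Differentiating `c` gives `-G ψ`; differentiating the divided monomial gives the sum of `G (ψ +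
  -- χ_b)` over `b`. After reindexing only `-G 0` survives.
  let G : (A →₀ ℕ) → R := fun ψ => u (prodOf ψ) * divPow y (χ - ψ) * c ((χ - ψ).degree + 1)
  have h1 : ∀ ψ ∈ Finset.Icc 0 χ, (ψ.multinomial : ℂ) •
        δ (prodOf ψ) (divPow y (χ - ψ) * c (χ - ψ).degree) =
      (∑ b ∈ (χ - ψ).support, (ψ.multinomial : ℂ) • G (ψ + Finsupp.single b 1)) -
        (ψ.multinomial : ℂ) • G ψ := fun ψ hψ => by
    rw [← Finset.smul_sum, ← smul_sub, Derivation.leibniz, hc, derivation_divPow, smul_eq_mul,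
      smul_eq_mul, Finset.mul_sum, add_comm, sub_eq_add_neg]
    congr 2
    · refine Finset.sum_congr rfl fun b hb => ?_
      have hd : (χ - ψ).degree = (χ - (ψ + Finsupp.single b 1)).degree + 1 := by
        rw [← tsub_tsub]
        conv_lhs => rw [← tsub_add_cancel_of_le (single_one_le hb), map_add, Finsupp.degree_single]
      simp only [G, prodOf_add_single]
      rw [hy, hd, tsub_tsub]
      ring
    · simp only [G]; ring
  rw [Finset.sum_congr rfl h1, Finset.sum_sub_distrib, sum_multinomial_smul_add_single,
    ← Finset.add_sum_erase (Finset.Icc 0 χ) (fun ψ => (ψ.multinomial : ℂ) • G ψ)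
      (a := 0) (by simp)]
  simp [G, prodOf_zero, Finsupp.multinomial]

end DivPow

/-! ### The action of the elements `q_i(φ, χ)` on polynomials -/

section QAction

variable {n : ℕ} {A : Type*} [CommRing A] [Algebra ℂ A] {κ : Type*} (bas : Module.Basis κ ℂ A)

theorem degree_sub_single_add_one {S : Type*} {φ : S →₀ ℕ} {d : S} (hd : d ∈ φ.support) :
    (φ - Finsupp.single d 1).degree + 1 = φ.degree := by
  conv_rhs => rw [← tsub_add_cancel_of_le (single_one_le hd), map_add, Finsupp.degree_single]

/-- The signed `j`-th falling derivative `(-1)^j k (k - 1) ⋯ (k - j + 1) y ^ (k - j)` of `y ^ k`. -/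
def fallingPow {R : Type*} [CommRing R] [Algebra ℂ R] (y : R) (k j : ℕ) : R :=
  ((-1) ^ j * (k.descFactorial j : ℂ)) • y ^ (k - j)

/-- Supplies the hypothesis on `c` in the telescoping sum. For `j ≥ k` both sides vanish with the
descending factorial, so truncated exponents do no harm. -/
theorem derivation_fallingPow {R : Type*} [CommRing R] [Algebra ℂ R] (δ : Derivation ℂ R R) (y : R)
    (k j : ℕ) : δ (fallingPow y k j) = -(δ y * fallingPow y k (j + 1)) := by
  rw [fallingPow, fallingPow, Derivation.map_smul, Derivation.leibniz_pow,
    ← Nat.cast_smul_eq_nsmul ℂ, Nat.descFactorial_succ, Nat.sub_sub, smul_smul, smul_eq_mul,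
    mul_comm (y ^ _), mul_smul_comm, ← neg_smul]
  congr 1
  push_cast
  ring

theorem mapDer_hElt_lo (i : Fin (n - 1)) (a b : A) :
    mapDer bas a (hElt i).val (linForm bas (lo i) b) = linForm bas (lo i) (a * b) := by
  rw [hElt, LieAlgebra.SpecialLinear.val_singleSubSingle, map_sub, Derivation.sub_apply,
    mapDer_single_linForm, mapDer_single_linForm, if_pos rfl, if_neg (lo_lt_hi i).ne', sub_zero]

theorem mapDer_xNeg_lo (i : Fin (n - 1)) (a b : A) :
    mapDer bas a (xNeg i).val (linForm bas (lo i) b) = linForm bas (hi i) (a * b) := by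
  rw [xNeg, LieAlgebra.SpecialLinear.val_single, mapDer_single_linForm, if_pos rfl]

theorem mapDer_xNeg_hi (i : Fin (n - 1)) (a b : A) :
    mapDer bas a (xNeg i).val (linForm bas (hi i) b) = 0 := by
  rw [xNeg, LieAlgebra.SpecialLinear.val_single, mapDer_single_linForm, if_neg (lo_lt_hi i).ne]

-- Strong induction on `|χ|`. The recursion omits `ψ = 0`; in the telescoping identity that term is
-- `|χ|` times the claimed value plus the boundary term, so the other terms sum to `-|χ|` times the
-- claimed value.
open Classical in
theorem polyAction_qElt_zero (i : Fin (n - 1)) (k : ℕ) {g : PolyRep n κ}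
    (hg : ∀ a, mapDer bas a (hElt i).val g = 0) (χ : A →₀ ℕ) :
    polyAction bas (qElt i 0 χ) (linForm bas (lo i) 1 ^ k * g) =
      divPow (linForm bas (lo i)) χ * fallingPow (linForm bas (lo i) 1) k χ.degree * g := by
  induction hN : χ.degree using Nat.strong_induction_on generalizing χ with
  | _ N ih =>
    subst hN
    by_cases hχ : χ = 0
    · subst hχ
      rw [qElt_zero_zero, map_one, Module.End.one_apply, divPow_zero]
      simp [fallingPow]
    · set y := linForm bas (lo i) with hy
      set c := fallingPow (y 1) k with hc
      have hd0 : (χ.degree : ℂ) ≠ 0 := by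
        exact_mod_cast fun h => hχ ((Finsupp.degree_eq_zero_iff χ).mp h)
      have hδ : ∀ a b, mapDer bas a (hElt i).val (y b) = y (a * b) := mapDer_hElt_lo bas i
      have hδc : ∀ a j, mapDer bas a (hElt i).val (c j) = -(y a * c (j + 1)) := fun a j => by
        rw [hc, derivation_fallingPow, hδ, mul_one]
      have hmain := sum_multinomial_smul_derivation (fun a => mapDer bas a (hElt i).val) y y c
        hδ hδc χ
      rw [← Finset.add_sum_erase _ _ (show (0 : A →₀ ℕ) ∈ Finset.Icc 0 χ by simp)] at hmain
      have h0 : ((0 : A →₀ ℕ).multinomial : ℂ) = 1 := by simp [Finsupp.multinomial]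
      rw [h0, one_smul, prodOf_zero, tsub_zero, Derivation.leibniz, hδc, derivation_divPow] at hmain
      simp only [hδ, one_mul, smul_eq_mul, sum_mul_divPow_sub_single] at hmain
      have hterm : ∀ ψ ∈ (Finset.Icc 0 χ).erase 0,
          polyAction bas ((ψ.multinomial : ℂ) • (el (hElt i) (prodOf ψ) * qElt i 0 (χ - ψ)))
            (y 1 ^ k * g) =
          ((ψ.multinomial : ℂ) • mapDer bas (prodOf ψ) (hElt i).val
            (divPow y (χ - ψ) * c (χ - ψ).degree)) * g := fun ψ hψ => by
        have hlt := degree_sub_lt (Finset.mem_Icc.mp (Finset.mem_of_mem_erase hψ)).2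
          (Finset.ne_of_mem_erase hψ)
        rw [map_smul, LinearMap.smul_apply, map_mul (polyAction bas), Module.End.mul_apply, ih _ hlt _ rfl,
          polyAction_el, Derivation.leibniz _ (_ * _) g, hg, smul_zero, zero_add, smul_eq_mul,
          mul_comm g, smul_mul_assoc]
      rw [qElt_zero_left i hχ, map_neg, map_smul, map_sum, LinearMap.neg_apply,
        LinearMap.smul_apply, LinearMap.sum_apply, Finset.sum_congr rfl hterm, ← Finset.sum_mul]
      rw [← smul_mul_assoc, ← neg_mul]
      congr 1
      rw [← smul_neg, inv_smul_eq_iff₀ hd0, ← smul_mul_assoc]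
      linear_combination -hmain

open Classical in
/-- The action of `q_i(φ, χ)` on `(e_i ⊗ 1) ^ k g`, where `g` is killed by `h_i ⊗ a` and
`x_{-i} ⊗ a`. -/
theorem polyAction_qElt (i : Fin (n - 1)) (k : ℕ) {g : PolyRep n κ}
    (hg : ∀ a, mapDer bas a (hElt i).val g = 0) (hg' : ∀ a, mapDer bas a (xNeg i).val g = 0)
    (φ χ : A →₀ ℕ) :
    polyAction bas (qElt i φ χ) (linForm bas (lo i) 1 ^ k * g) =
      divPow (linForm bas (hi i)) φ * divPow (linForm bas (lo i)) χ *
        fallingPow (linForm bas (lo i) 1) k (φ.degree + χ.degree) * g := by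
  induction hN : φ.degree using Nat.strong_induction_on generalizing φ χ with
  | _ N ih =>
    subst hN
    by_cases hφ : φ = 0
    · subst hφ
      rw [polyAction_qElt_zero bas i k hg, divPow_zero, one_mul, map_zero, zero_add]
    · set y := linForm bas (lo i) with hy
      set z := linForm bas (hi i) with hz
      have hd0 : (φ.degree : ℂ) ≠ 0 := by
        exact_mod_cast fun h => hφ ((Finsupp.degree_eq_zero_iff φ).mp h)
      have hterm : ∀ d ∈ φ.support, ∀ ψ ∈ Finset.Icc 0 χ,
          polyAction bas ((ψ.multinomial : ℂ) • (el (xNeg i) (d * prodOf ψ) *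
            qElt i (φ - Finsupp.single d 1) (χ - ψ))) (y 1 ^ k * g) =
          ((ψ.multinomial : ℂ) • mapDer bas (d * prodOf ψ) (xNeg i).val
            (divPow y (χ - ψ) * fallingPow (y 1) k
              ((φ - Finsupp.single d 1).degree + (χ - ψ).degree))) *
            (divPow z (φ - Finsupp.single d 1) * g) := fun d hd ψ _ => by
        have hlt := degree_sub_lt (single_one_le hd) (by simp)
        have hz0 : mapDer bas (d * prodOf ψ) (xNeg i).val
            (divPow z (φ - Finsupp.single d 1) * g) = 0 := by
          rw [Derivation.leibniz, hg', derivation_divPow]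
          simp [hz, mapDer_xNeg_hi]
        rw [map_smul, LinearMap.smul_apply, map_mul (polyAction bas), Module.End.mul_apply, ih _ hlt _ _ rfl,
          polyAction_el, mul_assoc (divPow z _), mul_comm (divPow z _), mul_assoc,
          Derivation.leibniz, hz0, smul_zero, zero_add, smul_eq_mul, smul_mul_assoc, mul_comm]
      have hsum : ∀ d ∈ φ.support, ∑ ψ ∈ Finset.Icc 0 χ,
          polyAction bas ((ψ.multinomial : ℂ) • (el (xNeg i) (d * prodOf ψ) *
            qElt i (φ - Finsupp.single d 1) (χ - ψ))) (y 1 ^ k * g) =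
          -(z d * divPow z (φ - Finsupp.single d 1)) *
            (divPow y χ * fallingPow (y 1) k (φ.degree + χ.degree) * g) := fun d hd => by
        -- For fixed `d` the sum over `ψ` telescopes, with the index of the falling power shifted by
        -- `|φ| - 1`; Euler's identity then handles the sum over `d`.
        have hmain := sum_multinomial_smul_derivation (fun a => mapDer bas (d * a) (xNeg i).val) y
          (fun a => z (d * a)) (fun j => fallingPow (y 1) k ((φ - Finsupp.single d 1).degree + j))
          (fun a b => by rw [hy, mapDer_xNeg_lo, mul_assoc])
          (fun a j => by rw [derivation_fallingPow, hy, mapDer_xNeg_lo, mul_one, add_assoc]) χ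
        have hdeg : (φ - Finsupp.single d 1).degree + (χ.degree + 1) = φ.degree + χ.degree := by
          rw [← degree_sub_single_add_one hd]; ring
        rw [Finset.sum_congr rfl (hterm d hd), ← Finset.sum_mul, hmain, mul_one, hdeg]
        ring
      rw [qElt_of_ne_zero i χ hφ, Finset.sum_comm, map_neg, map_smul, map_sum, LinearMap.neg_apply,
        LinearMap.smul_apply, LinearMap.sum_apply]
      simp only [map_sum, LinearMap.sum_apply]
      rw [Finset.sum_congr rfl hsum, ← Finset.sum_mul, Finset.sum_neg_distrib,
        sum_mul_divPow_sub_single, neg_mul, smul_neg, neg_neg, smul_mul_assoc,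
        inv_smul_smul₀ hd0]
      ring

end QAction

/-! ### The action of the product `q(φ_1, …, φ_n)` -/

section QProduct

variable {n : ℕ} {A : Type*} [CommRing A] [Algebra ℂ A] {κ : Type*} (bas : Module.Basis κ ℂ A)

theorem fallingPow_self {R : Type*} [CommRing R] [Algebra ℂ R] (y : R) (k : ℕ) :
    fallingPow y k k = ((-1) ^ k * (k.factorial : ℂ)) • (1 : R) := by
  rw [fallingPow, Nat.descFactorial_self, Nat.sub_self, pow_zero]

theorem divPow_smul_single_one {S R : Type*} [One S] [CommRing R] [Algebra ℂ R] (y : S → R) (k : ℕ) :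
    divPow y (k • Finsupp.single 1 1) = ((k.factorial : ℂ)⁻¹) • y 1 ^ k := by
  rw [divPow, Finsupp.smul_single, smul_eq_mul, mul_one, Finsupp.prod_single_index (by simp)]

/-- The product of the divided monomials attached to `φ_j` with `j < t`. -/
def divPowProd (φ : Fin n → A →₀ ℕ) (t : ℕ) : PolyRep n κ :=
  ∏ j ∈ Finset.univ.filter fun j : Fin n => (j : ℕ) < t, divPow (linForm bas j) (φ j)

theorem divPowProd_succ (φ : Fin n → A →₀ ℕ) (j : Fin n) :
    divPowProd bas φ (j + 1) = divPow (linForm bas j) (φ j) * divPowProd bas φ j := by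
  have h : (Finset.univ.filter fun i : Fin n => (i : ℕ) < j + 1) =
      insert j (Finset.univ.filter fun i : Fin n => (i : ℕ) < j) := by
    ext i; simp only [Finset.mem_filter_univ, Finset.mem_insert, Fin.ext_iff]; omega
  rw [divPowProd, h, Finset.prod_insert (by simp), divPowProd]

theorem mapDer_divPowProd (φ : Fin n → A →₀ ℕ) (t : ℕ) (a : A) (x : Matrix (Fin n) (Fin n) ℂ)
    (h : ∀ (j : Fin n) b, (j : ℕ) < t → mapDer bas a x (linForm bas j b) = 0) :
    mapDer bas a x (divPowProd bas φ t) = 0 := by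
  rw [divPowProd, derivation_prod]
  refine Finset.sum_eq_zero fun j hj => ?_
  rw [derivation_divPow, Finset.sum_eq_zero, zero_mul]
  intro b _
  rw [h j b (Finset.mem_filter.mp hj).2, zero_mul]

/-- The exponent `k` is exactly used up, so the falling power degenerates to the nonzero constant
`(-1)^k k!`. -/
theorem polyAction_qElt_divPowProd (φ : Fin n → A →₀ ℕ) (i : Fin (n - 1)) (k : ℕ) (ψ : A →₀ ℕ)
    (hk : k = ψ.degree + (φ (lo i)).degree) :
    polyAction bas (qElt i ψ (φ (lo i))) (linForm bas (lo i) 1 ^ k * divPowProd bas φ i) =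
      ((-1) ^ k * (k.factorial : ℂ)) •
        (divPow (linForm bas (hi i)) ψ * divPowProd bas φ (i + 1)) := by
  have hlt : ∀ j : Fin n, (j : ℕ) < i → lo i ≠ j ∧ hi i ≠ j := fun j hj =>
    ⟨fun h => by rw [← h] at hj; exact lt_irrefl _ hj,
      fun h => by rw [← h] at hj; simp only [hi] at hj; omega⟩
  rw [polyAction_qElt bas i k (fun a => mapDer_divPowProd bas φ i a _ fun j b hj => ?_)
    (fun a => mapDer_divPowProd bas φ i a _ fun j b hj => ?_), ← hk, fallingPow_self,
    show (i : ℕ) = (lo i : Fin n) from rfl, divPowProd_succ]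
  · rw [mul_smul_comm, mul_one, smul_mul_assoc, mul_assoc]
  · rw [hElt, LieAlgebra.SpecialLinear.val_singleSubSingle, map_sub, Derivation.sub_apply,
      mapDer_single_linForm, mapDer_single_linForm, if_neg (hlt j hj).1, if_neg (hlt j hj).2,
      sub_zero]
  · rw [xNeg, LieAlgebra.SpecialLinear.val_single, mapDer_single_linForm, if_neg (hlt j hj).1]

theorem sum_Ici_degree {S : Type*} (φ : Fin n → S →₀ ℕ) (j : Fin n) :
    ∑ i ∈ Finset.Ici j, (φ i).degree = (∑ i ∈ Finset.Ioi j, (φ i).degree) + (φ j).degree := by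
  rw [← Finset.Ioi_insert, Finset.sum_insert (by simp), add_comm]

/-- Invariant after `t` factors: the monomials of `φ_j` with `j < t` (0-based) are complete, and all
remaining degree sits in a power of `e_t ⊗ 1`. A first argument `N χ_1` moves the `N` unused factors
to `(e_{t+1} ⊗ 1)^N / N!`. -/
theorem exists_polyAction_qFactor_prod (hn : 0 < n - 1) (φ : Fin n → A →₀ ℕ) (m : ℕ)
    (hm : ∑ i, (φ i).degree = m) (t : ℕ) (ht : t < n - 1) :
    ∃ r : ℂ, r ≠ 0 ∧
      polyAction bas ((((List.finRange (n - 1)).take t).reverse.map (qFactor φ)).prod)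
        (linForm bas (lo ⟨0, hn⟩) 1 ^ m) =
      r • (linForm bas (lo ⟨t, ht⟩) 1 ^ (∑ j ∈ Finset.Ici (lo (⟨t, ht⟩ : Fin (n - 1))), (φ j).degree) *
        divPowProd bas φ t) := by
  induction t with
  | zero =>
    have h : Finset.Ici (lo (⟨0, ht⟩ : Fin (n - 1))) = Finset.univ := by
      ext j; simp [lo, Fin.le_def]
    refine ⟨1, one_ne_zero, ?_⟩
    rw [h, hm, one_smul]
    simp [divPowProd]
  | succ t ih =>
    have ht' : t < n - 1 := by omega
    obtain ⟨r, hr, h⟩ := ih ht'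
    have hq : qFactor φ (⟨t, ht'⟩ : Fin (n - 1)) = qElt ⟨t, ht'⟩
        ((∑ j ∈ Finset.Ioi (lo (⟨t, ht'⟩ : Fin (n - 1))), (φ j).degree) • Finsupp.single 1 1)
        (φ (lo ⟨t, ht'⟩)) := by
      rw [qFactor, if_neg (by simp only; omega)]
    have hI : Finset.Ioi (lo (⟨t, ht'⟩ : Fin (n - 1))) = Finset.Ici (lo ⟨t + 1, ht⟩) := by
      ext j; simp [lo, Fin.le_def, Fin.lt_def]
    have hH : hi (⟨t, ht'⟩ : Fin (n - 1)) = lo ⟨t + 1, ht⟩ := rfl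
    have hlen : t < (List.finRange (n - 1)).length := by simpa using ht'
    rw [← List.take_append_getElem hlen, List.reverse_append, List.map_append, List.prod_append,
      map_mul, Module.End.mul_apply, h, map_smul]
    simp only [List.reverse_singleton, List.map_singleton, List.prod_singleton,
      List.getElem_finRange]
    rw [show Fin.cast _ (⟨t, _⟩ : Fin (List.finRange (n - 1)).length) = ⟨t, ht'⟩ from rfl, hq,
      polyAction_qElt_divPowProd bas φ ⟨t, ht'⟩ _ _ (by simp [sum_Ici_degree]),
      divPow_smul_single_one, hI, hH, smul_mul_assoc, smul_smul, smul_smul]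
    refine ⟨_, ?_, rfl⟩
    refine mul_ne_zero (mul_ne_zero hr (mul_ne_zero (by simp) ?_)) (inv_ne_zero ?_) <;>
      exact_mod_cast Nat.factorial_ne_zero _

/-- Up to a nonzero scalar, `q(φ_1, …, φ_n)` sends `(e_1 ⊗ 1) ^ m` to the product of the divided
monomials attached to the `φ_j`. -/
theorem exists_polyAction_qProd (hn : 0 < n - 1) (φ : Fin n → A →₀ ℕ) (m : ℕ)
    (hm : ∑ i, (φ i).degree = m) :
    ∃ r : ℂ, r ≠ 0 ∧ polyAction bas (qProd φ) (linForm bas (lo ⟨0, hn⟩) 1 ^ m) =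
      r • ∏ j, divPow (linForm bas j) (φ j) := by
  have ht : n - 2 < n - 1 := by omega
  obtain ⟨r, hr, h⟩ := exists_polyAction_qFactor_prod bas hn φ m hm (n - 2) ht
  have hlen : n - 2 < (List.finRange (n - 1)).length := by simpa using ht
  -- The last factor writes the monomials of both remaining multisets, so no power of a vector `e_j
  -- ⊗ 1` is left over.
  have hq : qFactor φ (⟨n - 2, ht⟩ : Fin (n - 1)) = qElt ⟨n - 2, ht⟩
      (φ (hi ⟨n - 2, ht⟩)) (φ (lo ⟨n - 2, ht⟩)) := by
    rw [qFactor, if_pos (by simp only; omega)]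
  have hI : Finset.Ioi (lo (⟨n - 2, ht⟩ : Fin (n - 1))) = {hi ⟨n - 2, ht⟩} := by
    ext j
    simp only [lo, hi, Finset.mem_Ioi, Finset.mem_singleton, Fin.lt_def, Fin.ext_iff]
    omega
  have hall : (List.finRange (n - 1)) = (List.finRange (n - 1)).take (n - 2 + 1) :=
    (List.take_of_length_le (by simp; omega)).symm
  rw [qProd, hall, ← List.take_append_getElem hlen, List.reverse_append, List.map_append,
    List.prod_append, map_mul, Module.End.mul_apply, h, map_smul]
  simp only [List.reverse_singleton, List.map_singleton, List.prod_singleton,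
    List.getElem_finRange]
  rw [show Fin.cast _ (⟨n - 2, _⟩ : Fin (List.finRange (n - 1)).length) = ⟨n - 2, ht⟩ from rfl, hq,
    polyAction_qElt_divPowProd bas φ ⟨n - 2, ht⟩ _ _ (by simp [sum_Ici_degree, hI]), smul_smul]
  have h1 : divPow (linForm bas (hi ⟨n - 2, ht⟩)) (φ (hi ⟨n - 2, ht⟩)) *
      divPowProd bas φ (n - 2 + 1) = ∏ j, divPow (linForm bas j) (φ j) := by
    rw [show n - 2 + 1 = ((hi (⟨n - 2, ht⟩ : Fin (n - 1)) : Fin n) : ℕ) from rfl, ← divPowProd_succ,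
      divPowProd]
    refine Finset.prod_congr ?_ fun _ _ => rfl
    refine Finset.filter_true_of_mem fun j _ => ?_
    simp only [hi]
    omega
  rw [h1]
  exact ⟨_, mul_ne_zero hr (mul_ne_zero (by simp)
    (Nat.cast_ne_zero.mpr (Nat.factorial_ne_zero _))), rfl⟩

end QProduct

/-! ### The basis of the global Weyl module -/

section Basis

variable {n : ℕ} {A : Type*} {B : Set A}

/-- The exponent on `Fin n × B` attached to a tuple of multisets on `B`. -/
def expo (φ : Fin n → A →₀ ℕ) : Fin n × B →₀ ℕ :=
  ∑ j, ((φ j).comapDomain Subtype.val Subtype.val_injective.injOn).mapDomain (Prod.mk j)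

theorem expo_apply (φ : Fin n → A →₀ ℕ) (j : Fin n) (b : B) : expo φ (j, b) = φ j b := by
  rw [expo, Finsupp.finsetSum_apply, Finset.sum_eq_single j]
  · rw [Finsupp.mapDomain_apply (Prod.mk_right_injective j), Finsupp.comapDomain_apply]
  · intro i _ hi
    refine Finsupp.mapDomain_of_notMem_range _ _ ?_
    rintro ⟨c, hc⟩
    exact hi (congrArg Prod.fst hc)
  · simp

theorem mapDomain_comapDomain_val {f : A →₀ ℕ} (hf : (f.support : Set A) ⊆ B) :
    (f.comapDomain (Subtype.val : B → A) Subtype.val_injective.injOn).mapDomain Subtype.val = f :=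
  Finsupp.mapDomain_comapDomain _ Subtype.val_injective _ (by simpa using hf)

theorem degree_expo {φ : Fin n → A →₀ ℕ} (hφ : ∀ j, ((φ j).support : Set A) ⊆ B) :
    (expo φ : Fin n × B →₀ ℕ).degree = ∑ j, (φ j).degree := by
  rw [expo, map_sum]
  refine Finset.sum_congr rfl fun j _ => ?_
  rw [Finsupp.degree_mapDomain]
  conv_rhs => rw [← mapDomain_comapDomain_val (hφ j), Finsupp.degree_mapDomain]

theorem expo_injective (m : ℕ) :
    Function.Injective fun φ : Tuples n B m => (expo φ.1 : Fin n × B →₀ ℕ) := by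
  rintro ⟨φ, hφ, _⟩ ⟨ψ, hψ, _⟩ h
  refine Subtype.ext (funext fun j => ?_)
  change φ j = ψ j
  rw [← mapDomain_comapDomain_val (hφ j), ← mapDomain_comapDomain_val (hψ j)]
  congr 1
  ext b
  have := DFunLike.congr_fun h (j, b)
  simpa [expo_apply] using this

/-- Together with `expo_injective`, this matches tuples of total size `m` with the exponents of
degree `m`. -/
theorem exists_expo_eq {m : ℕ} {d : Fin n × B →₀ ℕ} (hd : d.degree = m) :
    ∃ φ : Tuples n B m, expo φ.1 = d := by
  let φ : Fin n → A →₀ ℕ := fun j =>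
    (d.comapDomain (Prod.mk j) (Prod.mk_right_injective j).injOn).mapDomain Subtype.val
  have hφ : ∀ j, ((φ j).support : Set A) ⊆ B := fun j a ha => by
    classical
    obtain ⟨b, _, rfl⟩ := Finset.mem_image.mp (Finsupp.mapDomain_support ha)
    exact b.2
  have h : expo φ = d := by
    ext ⟨j, b⟩
    rw [expo_apply, Finsupp.mapDomain_apply Subtype.val_injective, Finsupp.comapDomain_apply]
  exact ⟨⟨φ, hφ, by rw [← degree_expo hφ, h, hd]⟩, h⟩

variable [CommRing A] [Algebra ℂ A]

theorem exists_prod_divPow_eq (bas : Module.Basis B ℂ A) (hbas : ∀ b, bas b = (b : A))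
    {φ : Fin n → A →₀ ℕ} (hφ : ∀ j, ((φ j).support : Set A) ⊆ B) :
    ∃ r : ℂ, r ≠ 0 ∧ ∏ j, divPow (linForm bas j) (φ j) = r • MvPolynomial.monomial (expo φ) 1 := by
  have key : ∀ j, ∃ r : ℂ, r ≠ 0 ∧ divPow (linForm bas j) (φ j) = r • MvPolynomial.monomial
      (((φ j).comapDomain (Subtype.val : B → A) Subtype.val_injective.injOn).mapDomain
        (Prod.mk j)) 1 := by
    intro j
    set s := (φ j).comapDomain (Subtype.val : B → A) Subtype.val_injective.injOn
    refine ⟨∏ b ∈ s.support, ((s b).factorial : ℂ)⁻¹, Finset.prod_ne_zero_iff.mpr fun b _ =>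
      inv_ne_zero (Nat.cast_ne_zero.mpr (Nat.factorial_ne_zero _)), ?_⟩
    rw [← mapDomain_comapDomain_val (hφ j), divPow,
      Finsupp.prod_mapDomain_index_inj Subtype.val_injective, MvPolynomial.monomial_eq,
      Finsupp.prod_mapDomain_index_inj (Prod.mk_right_injective j), map_one, one_mul,
      Finsupp.prod, Finsupp.prod, Finset.prod_smul]
    refine congrArg _ (Finset.prod_congr rfl fun b _ => ?_)
    rw [← hbas, linForm_basis]
  choose r hr h using key
  refine ⟨∏ j, r j, Finset.prod_ne_zero_iff.mpr fun j _ => hr j, ?_⟩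
  rw [Finset.prod_congr rfl fun j _ => h j, Finset.prod_smul, expo, MvPolynomial.monomial_sum_one]

end Basis

end GlobalWeyl

end

/-! ### The main theorem -/

theorem mainTheorem1 (n : ℕ) (hn : 2 ≤ n) (A : Type*) [CommRing A] [Algebra ℂ A]
    (B : Set A) (hB_indep : LinearIndependent ℂ (fun b : B => (b : A)))
    (hB_span : Submodule.span ℂ B = ⊤) (m : ℕ) (hm : 0 < m) :
    LinearIndependent ℂ (fun φ : GlobalWeyl.Tuples n B m =>
      GlobalWeyl.qProd φ.1 •
        GlobalWeyl.highestWeightVector n A (GlobalWeyl.mulOmegaOne n m)) ∧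
    Submodule.span ℂ (Set.range fun φ : GlobalWeyl.Tuples n B m =>
      GlobalWeyl.qProd φ.1 •
        GlobalWeyl.highestWeightVector n A (GlobalWeyl.mulOmegaOne n m)) = ⊤ := by
  have hn' : 0 < n - 1 := by omega
  let bas : Module.Basis B ℂ A := Module.Basis.mk hB_indep (by simp [hB_span])
  have hbas : ∀ b, bas b = (b : A) := fun b => by simp [bas]
  obtain ⟨Ψ, hΨ⟩ := GlobalWeyl.exists_weylModule_toPoly bas hn' m
  have hinj := GlobalWeyl.weylModule_toPoly_injective bas hn' m Ψ hΨ
  have hq : ∀ φ : GlobalWeyl.Tuples n B m, ∃ r : ℂ, r ≠ 0 ∧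
      Ψ (GlobalWeyl.qProd φ.1 •
        GlobalWeyl.highestWeightVector n A (GlobalWeyl.mulOmegaOne n m)) =
      r • MvPolynomial.monomial (GlobalWeyl.expo φ.1) 1 := fun φ => by
    obtain ⟨r, hr, h⟩ := GlobalWeyl.exists_polyAction_qProd bas hn' φ.1 m φ.2.2
    obtain ⟨s, hs, h'⟩ := GlobalWeyl.exists_prod_divPow_eq bas hbas φ.2.1
    exact ⟨r * s, mul_ne_zero hr hs, by rw [hΨ, h, h', smul_smul]⟩
  choose r hr hq using hq
  constructor
  -- Under `Ψ` the family becomes nonzero multiples of distinct monomials.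
  · refine LinearIndependent.of_comp Ψ ?_
    have h1 := ((MvPolynomial.basisMonomials (Fin n × B) ℂ).linearIndependent.comp _
      (GlobalWeyl.expo_injective m)).units_smul fun φ => Units.mk0 (r φ) (hr φ)
    have h2 : (Ψ ∘ fun φ : GlobalWeyl.Tuples n B m => GlobalWeyl.qProd φ.1 •
        GlobalWeyl.highestWeightVector n A (GlobalWeyl.mulOmegaOne n m)) =
        (fun φ => Units.mk0 (r φ) (hr φ)) • (MvPolynomial.basisMonomials (Fin n × B) ℂ) ∘
          fun φ => GlobalWeyl.expo φ.1 := by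
      funext φ
      simpa [Units.smul_def] using hq φ
    rw [h2]
    exact h1
  · refine (Submodule.eq_top_iff').mpr fun v => ?_
    obtain ⟨u, rfl⟩ := GlobalWeyl.exists_smul_highestWeightVector v
    set N := Submodule.span ℂ (Set.range fun φ : GlobalWeyl.Tuples n B m => GlobalWeyl.qProd φ.1 •
      GlobalWeyl.highestWeightVector n A (GlobalWeyl.mulOmegaOne n m)) with hN
    suffices h : Ψ (u • GlobalWeyl.highestWeightVector n A (GlobalWeyl.mulOmegaOne n m)) ∈
        N.map Ψ by
      obtain ⟨v, hv, e⟩ := h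
      rwa [← hinj e]
    -- The image of `Ψ` lies in degree `m`, where every monomial is a multiple of the image of some
    -- `q(φ) w`; injectivity pulls the expansion back to the Weyl module.
    have hhom : (Ψ (u • GlobalWeyl.highestWeightVector n A
        (GlobalWeyl.mulOmegaOne n m))).IsHomogeneous m := by
      rw [hΨ]
      refine GlobalWeyl.polyAction_isHomogeneous bas u ?_
      simpa using (GlobalWeyl.linForm_isHomogeneous bas _ 1).pow m
    rw [MvPolynomial.as_sum (Ψ _)]
    refine Submodule.sum_mem _ fun d hd => ?_
    have hdeg : d.degree = m := by
      by_contra h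
      exact MvPolynomial.mem_support_iff.mp hd (hhom.coeff_eq_zero h)
    obtain ⟨φ, rfl⟩ := GlobalWeyl.exists_expo_eq hdeg
    rw [← mul_one (MvPolynomial.coeff _ _), ← smul_eq_mul, ← MvPolynomial.smul_monomial]
    refine Submodule.smul_mem _ _ ⟨(r φ)⁻¹ • (GlobalWeyl.qProd φ.1 •
      GlobalWeyl.highestWeightVector n A (GlobalWeyl.mulOmegaOne n m)),
      Submodule.smul_mem _ _ (Submodule.subset_span ⟨φ, rfl⟩), ?_⟩
    rw [map_smul, hq, inv_smul_smul₀ (hr φ)]
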